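/- Let $A\in\mathbb C^{n\times n}$, $B\in\mathbb C^{n\times m}$, $R\in\mathbb C^{m\times m}$ Hermitian positive definite, $C\in\mathbb C^{l\times n}$, and put $G=BR^{-1}B^H$, $H=C^HC$. Write $X\ge Y$ if $X-Y$ is Hermitian positive semidefinite, $\|\cdot\|$ for the spectral norm, $\rho$ for the spectral radius, and $\rho_{\mathbb D}(M)=\max\{|\lambda| : \lambda\in\sigma(M),\ |\lambda|<1\}$ (with value $0$ if $M$ has no eigenvalue in the open unit disk). For Hermitian $X$ with $\det(R+B^HXB)\ne0$ put $\mathcal R(X)=A^HX(I+GX)^{-1}A+H$, $F_X=(R+B^HXB)^{-1}B^HXA$, $T_X=A-BF_X$ and $H_X=H+F_X^HRF_X$. Let $\mathcal R_=$ and $\mathcal R_\ge$ be the sets of such $X$ with $X=\mathcal R(X)$ and with $X\ge\mathcal R(X)$, respectively, and let $\mathbb N_n$ be the set of $n\times n$ Hermitian positive semidefinite matrices. Assume that there is a Hermitian $X_\star$ with $\det(R+B^HX_\star B)\neq 0$ and $\rho(T_{X_\star})<1$. Let $r\ge2$ be an integer, and let $\widehat X_0$ be the Hermitian solution of $\widehat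 X_0-T_{X_\star}^H\widehat X_0T_{X_\star}=H_{X_\star}$. Algorithm AFPI($r$) starts from $(\mathbf A_0,\mathbf G_0,\mathbf H_0)=(A,G,H)$. Given $(\mathbf A_k,\mathbf G_k,\mathbf H_k)$, it sets $(A_k^{(1)},G_k^{(1)},H_k^{(1)})=(\mathbf A_k,\mathbf G_k,\mathbf H_k)$ and, for $1\le j\le r-1$, $$A_k^{(j+1)}=A_k^{(j)}(I+\mathbf G_kH_k^{(j)})^{-1}\mathbf A_k,$$ $$G_k^{(j+1)}=G_k^{(j)}+A_k^{(j)}(I+\mathbf G_kH_k^{(j)})^{-1}\mathbf G_k(A_k^{(j)})^H,$$ $$H_k^{(j+1)}=\mathbf H_k+\mathbf A_k^HH_k^{(j)}(I+\mathbf G_kH_k^{(j)})^{-1}\mathbf A_k,$$ and then $(\mathbf A_{k+1},\mathbf G_{k+1},\mathbf H_{k+1})=(A_k^{(r)},G_k^{(r)},H_k^{(r)})$ and $\widehat X_{k+1}=\mathbf A_{k+1}^H\widehat X_0(I+\mathbf G_{k+1}\widehat X_0)^{-1}\mathbf A_{k+1}+\mathbf H_{k+1}$. A sequence $(X_k)$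 is said to converge at least R-superlinearly to $X$ with order $r$ if $\limsup_{k\to\infty}\|X_k-X\|^{1/r^k}\le\sigma$ for some $\sigma\in(0,1)$. Then $\widehat X_0$ exists and is unique, all inverses in the algorithm exist, there is a minimal positive semidefinite solution $X_{+,m}$ (the least element of $\mathcal R_=\cap\mathbb N_n$, which is also the least element of $\mathcal R_\ge\cap\mathbb N_n$), there is a maximal positive semidefinite solution $X_{+,M}$ (the greatest element of $\mathcal R_=\cap\mathbb N_n$), and: (i) $(\mathbf H_k)$ converges to $X_{+,m}$, at least R-superlinearly with order $r$, and $$\limsup_{k\to\infty}\|\mathbf H_k-X_{+,m}\|^{1/r^k}\le\rho_{\mathbb D}(T_{X_{+,m}})^2<1;$$ (ii) if $\rho(T_{X_{+,M}})<1$, then $(\widehat X_k)$ converges to $X_{+,M}$, at least R-superlinearly with order $r$, and $$\limsup_{k\to\infty}\|\widehat X_k-X_{+,M}\|^{1/r^k}\le\rho(T_{X_{+,M}})^2.$$ -/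

import Mathlib

open Filter Topology
open scoped ENNReal Matrix ComplexOrder MatrixOrder Matrix.Norms.L2Operator

/-! Throughout, `≤` on complex square matrices is the Loewner order (`X ≤ Y` iff `Y - X` is
Hermitian positive semidefinite) and the norm of a matrix is the spectral norm. -/

namespace AFPI

noncomputable section

/-- The matrix `G = B R⁻¹ Bᴴ`. -/
def gMat {n m : ℕ} (B : Matrix (Fin n) (Fin m) ℂ) (R : Matrix (Fin m) (Fin m) ℂ) :
    Matrix (Fin n) (Fin n) ℂ :=
  B * R⁻¹ * Bᴴ

/-- The Riccati operator `𝓡(X) = Aᴴ X (I + G X)⁻¹ A + H`. -/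
def riccati {n : ℕ} (A G H X : Matrix (Fin n) (Fin n) ℂ) : Matrix (Fin n) (Fin n) ℂ :=
  Aᴴ * X * (1 + G * X)⁻¹ * A + H

/-- The domain of the Riccati operator: Hermitian `X` with `det (R + Bᴴ X B) ≠ 0`. -/
def riccatiDom {n m : ℕ} (B : Matrix (Fin n) (Fin m) ℂ) (R : Matrix (Fin m) (Fin m) ℂ) :
    Set (Matrix (Fin n) (Fin n) ℂ) :=
  {X | X.IsHermitian ∧ (R + Bᴴ * X * B).det ≠ 0}

/-- Solutions of the Riccati equation `X = 𝓡(X)`. -/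
def riccatiEq {n m : ℕ} (A : Matrix (Fin n) (Fin n) ℂ) (B : Matrix (Fin n) (Fin m) ℂ)
    (R : Matrix (Fin m) (Fin m) ℂ) (H : Matrix (Fin n) (Fin n) ℂ) :
    Set (Matrix (Fin n) (Fin n) ℂ) :=
  {X | X ∈ riccatiDom B R ∧ X = riccati A (gMat B R) H X}

/-- Solutions of the Riccati inequality `X ≥ 𝓡(X)`. -/
def riccatiGe {n m : ℕ} (A : Matrix (Fin n) (Fin n) ℂ) (B : Matrix (Fin n) (Fin m) ℂ)
    (R : Matrix (Fin m) (Fin m) ℂ) (H : Matrix (Fin n) (Fin n) ℂ) :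
    Set (Matrix (Fin n) (Fin n) ℂ) :=
  {X | X ∈ riccatiDom B R ∧ riccati A (gMat B R) H X ≤ X}

/-- The cone of Hermitian positive semidefinite matrices. -/
def psdCone (n : ℕ) : Set (Matrix (Fin n) (Fin n) ℂ) :=
  {X | X.PosSemidef}

/-- The feedback matrix `F_X = (R + Bᴴ X B)⁻¹ Bᴴ X A`. -/
def feedback {n m : ℕ} (A : Matrix (Fin n) (Fin n) ℂ) (B : Matrix (Fin n) (Fin m) ℂ)
    (R : Matrix (Fin m) (Fin m) ℂ) (X : Matrix (Fin n) (Fin n) ℂ) :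
    Matrix (Fin m) (Fin n) ℂ :=
  (R + Bᴴ * X * B)⁻¹ * Bᴴ * X * A

/-- The closed-loop matrix `T_X = A - B F_X`. -/
def closedLoop {n m : ℕ} (A : Matrix (Fin n) (Fin n) ℂ) (B : Matrix (Fin n) (Fin m) ℂ)
    (R : Matrix (Fin m) (Fin m) ℂ) (X : Matrix (Fin n) (Fin n) ℂ) :
    Matrix (Fin n) (Fin n) ℂ :=
  A - B * feedback A B R X

/-- The matrix `H_X = H + F_Xᴴ R F_X`. -/
def hMat {n m : ℕ} (A : Matrix (Fin n) (Fin n) ℂ) (B : Matrix (Fin n) (Fin m) ℂ)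
    (R : Matrix (Fin m) (Fin m) ℂ) (H X : Matrix (Fin n) (Fin n) ℂ) :
    Matrix (Fin n) (Fin n) ℂ :=
  H + (feedback A B R X)ᴴ * R * feedback A B R X

/-- The Stein operator `𝓢_T(X) = X - Tᴴ X T`. -/
def stein {n : ℕ} (T X : Matrix (Fin n) (Fin n) ℂ) : Matrix (Fin n) (Fin n) ℂ :=
  X - Tᴴ * X * T

/-- `ρ_𝔻(M)`: the largest modulus of an eigenvalue of `M` inside the open unit disk, with the
convention that it is `0` if there is no such eigenvalue. -/
def rhoDisk {n : ℕ} (M : Matrix (Fin n) (Fin n) ℂ) : ℝ≥0∞ :=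
  ⨆ z ∈ spectrum ℂ M ∩ Metric.ball (0 : ℂ) 1, ‖z‖ₑ

/-- The triples `(A, G, H)` on which the accelerated iteration acts. -/
@[ext]
structure Triple (n : ℕ) where
  A : Matrix (Fin n) (Fin n) ℂ
  G : Matrix (Fin n) (Fin n) ℂ
  H : Matrix (Fin n) (Fin n) ℂ

/-- One step of the inner loop: from the outer iterate `X = (𝐀, 𝐆, 𝐇)` and the current inner
iterate `Y = (A, G, H)` to
`(A (I + 𝐆 H)⁻¹ 𝐀, G + A (I + 𝐆 H)⁻¹ 𝐆 Aᴴ, 𝐇 + 𝐀ᴴ H (I + 𝐆 H)⁻¹ 𝐀)`. -/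
def innerStep {n : ℕ} (X Y : Triple n) : Triple n where
  A := Y.A * (1 + X.G * Y.H)⁻¹ * X.A
  G := Y.G + Y.A * (1 + X.G * Y.H)⁻¹ * X.G * Y.Aᴴ
  H := X.H + X.Aᴴ * Y.H * (1 + X.G * Y.H)⁻¹ * X.A

/-- The inner iterates that start from the outer iterate `X`; `inner X j` is the triple with
superscript `(j + 1)` of the algorithm, so that the superscript `(1)` belongs to `X` itself. -/
def inner {n : ℕ} (X : Triple n) : ℕ → Triple n
  | 0 => X
  | j + 1 => innerStep X (inner X j)

/-- The outer iterates `(𝐀ₖ, 𝐆ₖ, 𝐇ₖ)` of the accelerated fixed-point iteration of order `r`: the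
next outer iterate is what `r - 1` steps of the inner loop make of the present one. -/
def outer {n : ℕ} (r : ℕ) (X₀ : Triple n) : ℕ → Triple n
  | 0 => X₀
  | k + 1 => inner (outer r X₀ k) (r - 1)

/-- The iterates `X̂ₖ` with the initial matrix `X̂₀`, where
`X̂ₖ = 𝐀ₖᴴ X̂₀ (I + 𝐆ₖ X̂₀)⁻¹ 𝐀ₖ + 𝐇ₖ` for `k ≥ 1`. -/
def xHat {n : ℕ} (r : ℕ) (X₀ : Triple n) (Xinit : Matrix (Fin n) (Fin n) ℂ) :
    ℕ → Matrix (Fin n) (Fin n) ℂ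
  | 0 => Xinit
  | k + 1 =>
    (outer r X₀ (k + 1)).Aᴴ * Xinit * (1 + (outer r X₀ (k + 1)).G * Xinit)⁻¹ *
      (outer r X₀ (k + 1)).A + (outer r X₀ (k + 1)).H

/-- `limsup_k ‖Xₖ - X⋆‖ ^ (1 / r ^ k)`, an element of `[0, ∞]`. -/
def rootLimsup {n : ℕ} (r : ℕ) (X : ℕ → Matrix (Fin n) (Fin n) ℂ)
    (Xstar : Matrix (Fin n) (Fin n) ℂ) : ℝ≥0∞ :=
  limsup (fun k : ℕ => ‖X k - Xstar‖ₑ ^ (1 / (r : ℝ) ^ k)) atTop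

/-- Convergence at least R-superlinearly with order `r > 1`. -/
def ConvergesRSuperlinearly {n : ℕ} (r : ℕ) (X : ℕ → Matrix (Fin n) (Fin n) ℂ)
    (Xstar : Matrix (Fin n) (Fin n) ℂ) : Prop :=
  1 < r ∧ ∃ σ : ℝ, 0 < σ ∧ σ < 1 ∧ rootLimsup r X Xstar ≤ ENNReal.ofReal σ

end

end AFPI

/-!
The algorithm is the Riccati fixed-point iteration in disguise. To a triple `(A, G, H)` with `G`
and `H` positive semidefinite belongs the operator `X ↦ Aᴴ X (1 + G X)⁻¹ A + H`, and an inner step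
composes two such operators (`map_innerStep`). With `𝓡` the operator of the initial data, the
`k`-th outer iterate therefore represents `𝓡` iterated `r ^ k` times (`map_outer`), so that
`𝐇ₖ = 𝓡^[r ^ k] 0` and `X̂ₖ = 𝓡^[r ^ k] X̂₀`. All inverses exist since `1 + G X` is invertible for
positive semidefinite `G` and `X` (`isUnit_one_add_mul`). It remains to study the plain iteration.

Everything about `𝓡` rests on `riccati_sub`, which expresses `𝓡 X - 𝓡 Y` through `D = X - Y` and
the closed-loop matrix `T = (1 + G Y)⁻¹ A` of `Y` as `Tᴴ (D - D W D) T`, where `W` is positive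
semidefinite. It shows that `𝓡` is monotone. Completion of squares (`completion_of_squares`)
shows that the solution `X̂₀` of the Stein equation satisfies `𝓡 X̂₀ ≤ X̂₀` and dominates every
positive semidefinite solution (`le_of_stein_eq`). Hence `𝓡^[k] 0` increases to the minimal
solution and `𝓡^[k] X̂₀` decreases to the maximal one.

For the rates, let `P` be the limit and `T` its closed-loop matrix. From above, `riccati_sub` gives
`E (k + 1) ≤ Tᴴ (E k) T` for the errors, and Gelfand's formula for `T` finishes the estimate. From
below it gives `D (k + 1) ≤ (1 + ‖G‖ ‖D k‖) Tᴴ (D k) T` with `D 0 = P` and `D k → 0`. The scalar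
factors do not affect the exponential rate (`exists_prod_le`), so the decay of `(Tᵏ)ᴴ P Tᵏ` is what
matters, that is, of `T` modulo the `T`-invariant kernel of `P`. There all eigenvalues lie in the
open unit disk (`exists_norm_conj_pow_le`): those of larger modulus are excluded by `Tᴴ P T ≤ P`,
and those of modulus `1` by the minimality of `P` (`mulVec_eq_zero_of_unit_eigenvalue`).
-/

namespace AFPI

/-! ### Inverses of `1 + G X` for positive semidefinite `G` and `X` -/

section Algebra

variable {n m : ℕ} {A G H X Y : Matrix (Fin n) (Fin n) ℂ}

lemma conjTranspose_eq_of_nonneg (hX : 0 ≤ X) : Xᴴ = X :=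
  (Matrix.nonneg_iff_posSemidef.1 hX).isHermitian

lemma isUnit_one_add_mul (hG : 0 ≤ G) (hX : 0 ≤ X) : IsUnit (1 + G * X) := by
  have hS := CFC.sqrt_mul_sqrt_self G hG
  have hS0 : 0 ≤ CFC.sqrt G := CFC.sqrt_nonneg G
  set S := CFC.sqrt G
  rw [Matrix.isUnit_iff_isUnit_det, ← hS, mul_assoc, Matrix.det_one_add_mul_comm,
    ← Matrix.isUnit_iff_isUnit_det]
  refine (Matrix.PosDef.one.add_posSemidef (Matrix.nonneg_iff_posSemidef.1 ?_)).isUnit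
  simpa [Matrix.star_eq_conjTranspose, conjTranspose_eq_of_nonneg hS0]
    using star_left_conjugate_nonneg hX S

lemma mul_inv_one_add_mul (hG : 0 ≤ G) (hX : 0 ≤ X) : (1 + G * X) * (1 + G * X)⁻¹ = 1 :=
  Matrix.mul_nonsing_inv _ ((Matrix.isUnit_iff_isUnit_det _).1 (isUnit_one_add_mul hG hX))

lemma inv_one_add_mul_mul (hG : 0 ≤ G) (hX : 0 ≤ X) : (1 + G * X)⁻¹ * (1 + G * X) = 1 :=
  Matrix.nonsing_inv_mul _ ((Matrix.isUnit_iff_isUnit_det _).1 (isUnit_one_add_mul hG hX))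

lemma conjTranspose_inv_one_add_mul (hG : 0 ≤ G) (hX : 0 ≤ X) :
    ((1 + G * X)⁻¹)ᴴ = (1 + X * G)⁻¹ := by
  simp [Matrix.conjTranspose_nonsing_inv, conjTranspose_eq_of_nonneg hG,
    conjTranspose_eq_of_nonneg hX]

lemma inv_one_add_mul_comm (hG : 0 ≤ G) (hX : 0 ≤ X) :
    (1 + G * X)⁻¹ * G = G * (1 + X * G)⁻¹ := by
  calc (1 + G * X)⁻¹ * G = (1 + G * X)⁻¹ * (G * ((1 + X * G) * (1 + X * G)⁻¹)) := by
        rw [mul_inv_one_add_mul hX hG, mul_one]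
    _ = ((1 + G * X)⁻¹ * (1 + G * X)) * (G * (1 + X * G)⁻¹) := by noncomm_ring
    _ = _ := by rw [inv_one_add_mul_mul hG hX, one_mul]

lemma inv_one_add_mul_mul_nonneg (hG : 0 ≤ G) (hX : 0 ≤ X) : 0 ≤ (1 + G * X)⁻¹ * G := by
  have h : (1 + G * X)⁻¹ * G = star ((1 + X * G)⁻¹) * (G + star G * X * G) * (1 + X * G)⁻¹ := by
    rw [Matrix.star_eq_conjTranspose, Matrix.star_eq_conjTranspose,
      conjTranspose_inv_one_add_mul hX hG, conjTranspose_eq_of_nonneg hG]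
    calc (1 + G * X)⁻¹ * G = ((1 + G * X)⁻¹ * G) * ((1 + X * G) * (1 + X * G)⁻¹) := by
          rw [mul_inv_one_add_mul hX hG, mul_one]
      _ = _ := by noncomm_ring
  rw [h]
  exact star_left_conjugate_nonneg (add_nonneg hG (star_left_conjugate_nonneg hX G)) _

lemma mul_inv_one_add_mul_nonneg (hG : 0 ≤ G) (hX : 0 ≤ X) : 0 ≤ X * (1 + G * X)⁻¹ := by
  rw [← inv_one_add_mul_comm hX hG]
  exact inv_one_add_mul_mul_nonneg hX hG

lemma inv_one_add_mul_mul_le (hG : 0 ≤ G) (hX : 0 ≤ X) : (1 + G * X)⁻¹ * G ≤ G := by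
  rw [← sub_nonneg]
  have h : G - (1 + G * X)⁻¹ * G = star G * (X * (1 + G * X)⁻¹) * G := by
    rw [Matrix.star_eq_conjTranspose, conjTranspose_eq_of_nonneg hG]
    calc G - (1 + G * X)⁻¹ * G
        = ((1 + G * X) * (1 + G * X)⁻¹) * G - (1 + G * X)⁻¹ * G := by
          rw [mul_inv_one_add_mul hG hX, one_mul]
      _ = _ := by noncomm_ring
  rw [h]
  exact star_left_conjugate_nonneg (mul_inv_one_add_mul_nonneg hG hX) _

/-! ### The Riccati operator: difference formula and monotonicity -/

lemma mul_inv_one_add_mul_sub (hG : 0 ≤ G) (hX : 0 ≤ X) (hY : 0 ≤ Y) :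
    X * (1 + G * X)⁻¹ - Y * (1 + G * Y)⁻¹ = (1 + Y * G)⁻¹ * (X - Y) * (1 + G * X)⁻¹ := by
  rw [← inv_one_add_mul_comm hY hG]
  calc X * (1 + G * X)⁻¹ - (1 + Y * G)⁻¹ * Y
      = ((1 + Y * G)⁻¹ * (1 + Y * G)) * X * (1 + G * X)⁻¹
        - (1 + Y * G)⁻¹ * Y * ((1 + G * X) * (1 + G * X)⁻¹) := by
        rw [mul_inv_one_add_mul hG hX, inv_one_add_mul_mul hY hG, one_mul, mul_one]
    _ = _ := by noncomm_ring

/-- The increment of the Riccati operator, written with the closed-loop matrix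
`(1 + G Y)⁻¹ A` of the base point only. The quadratic correction
`(X - Y) (1 + G X)⁻¹ G (X - Y)` is positive semidefinite; its sign gives monotonicity of the
operator, and its size governs the speed of convergence. -/
lemma riccati_sub (hG : 0 ≤ G) (hX : 0 ≤ X) (hY : 0 ≤ Y) :
    riccati A G H X - riccati A G H Y = star ((1 + G * Y)⁻¹ * A) *
      ((X - Y) - (X - Y) * ((1 + G * X)⁻¹ * G) * (X - Y)) * ((1 + G * Y)⁻¹ * A) := by
  have h1 : (1 + G * X)⁻¹ = (1 - (1 + G * X)⁻¹ * G * (X - Y)) * (1 + G * Y)⁻¹ := by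
    calc (1 + G * X)⁻¹ = (1 + G * X)⁻¹ * ((1 + G * Y) * (1 + G * Y)⁻¹) := by
          rw [mul_inv_one_add_mul hG hY, mul_one]
      _ = ((1 + G * X)⁻¹ * (1 + G * X) - (1 + G * X)⁻¹ * G * (X - Y)) * (1 + G * Y)⁻¹ := by
          noncomm_ring
      _ = _ := by rw [inv_one_add_mul_mul hG hX]
  have h2 := mul_inv_one_add_mul_sub hG hX hY
  rw [star_mul, Matrix.star_eq_conjTranspose, Matrix.star_eq_conjTranspose,
    conjTranspose_inv_one_add_mul hG hY]
  calc riccati A G H X - riccati A G H Y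
      = Aᴴ * (X * (1 + G * X)⁻¹ - Y * (1 + G * Y)⁻¹) * A := by
        unfold riccati; noncomm_ring
    _ = Aᴴ * ((1 + Y * G)⁻¹ * (X - Y) *
          ((1 - (1 + G * X)⁻¹ * G * (X - Y)) * (1 + G * Y)⁻¹)) * A := by rw [h2, ← h1]
    _ = _ := by noncomm_ring

lemma riccati_nonneg (hG : 0 ≤ G) (hH : 0 ≤ H) (hX : 0 ≤ X) : 0 ≤ riccati A G H X := by
  have h := star_left_conjugate_nonneg (mul_inv_one_add_mul_nonneg hG hX) A
  rw [Matrix.star_eq_conjTranspose] at h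
  unfold riccati
  rw [mul_assoc Aᴴ]
  exact add_nonneg h hH

@[simp] lemma riccati_zero : riccati A G H 0 = H := by simp [riccati]

lemma riccati_mono (hG : 0 ≤ G) (hX : 0 ≤ X) (hXY : X ≤ Y) :
    riccati A G H X ≤ riccati A G H Y := by
  have hY := hX.trans hXY
  have hD : 0 ≤ Y - X := sub_nonneg.2 hXY
  rw [← sub_nonneg, ← neg_sub, riccati_sub hG hX hY, ← neg_mul, ← mul_neg]
  refine star_left_conjugate_nonneg ?_ _
  have h : -((X - Y) - (X - Y) * ((1 + G * X)⁻¹ * G) * (X - Y)) =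
      (Y - X) + star (Y - X) * ((1 + G * X)⁻¹ * G) * (Y - X) := by
    rw [Matrix.star_eq_conjTranspose, conjTranspose_eq_of_nonneg hD]; noncomm_ring
  rw [h]
  exact add_nonneg hD (star_left_conjugate_nonneg (inv_one_add_mul_mul_nonneg hG hX) _)

/-- Above the base point the Riccati operator increases at most as fast as its linearization. -/
lemma riccati_sub_le (hG : 0 ≤ G) (hY : 0 ≤ Y) (hYX : Y ≤ X) :
    riccati A G H X - riccati A G H Y ≤
      star ((1 + G * Y)⁻¹ * A) * (X - Y) * ((1 + G * Y)⁻¹ * A) := by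
  have hX := hY.trans hYX
  have hD : 0 ≤ X - Y := sub_nonneg.2 hYX
  rw [riccati_sub hG hX hY]
  refine star_left_conjugate_le_conjugate (sub_le_self _ ?_) _
  have := star_left_conjugate_nonneg (inv_one_add_mul_mul_nonneg hG hX) (X - Y)
  rwa [Matrix.star_eq_conjTranspose, conjTranspose_eq_of_nonneg hD] at this

/-- Below the base point the defect of the Riccati operator exceeds that of its linearization by
a factor that tends to `1` as the two points approach each other. -/
lemma riccati_sub_le_smul (hG : 0 ≤ G) (hX : 0 ≤ X) (hXY : X ≤ Y) :
    riccati A G H Y - riccati A G H X ≤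
      (1 + ‖G‖ * ‖Y - X‖) • (star ((1 + G * Y)⁻¹ * A) * (Y - X) * ((1 + G * Y)⁻¹ * A)) := by
  have hY := hX.trans hXY
  have hD : 0 ≤ Y - X := sub_nonneg.2 hXY
  rw [← neg_sub, riccati_sub hG hX hY, ← neg_mul, ← mul_neg, ← smul_mul_assoc, ← mul_smul_comm]
  refine star_left_conjugate_le_conjugate ?_ _
  have h : -((X - Y) - (X - Y) * ((1 + G * X)⁻¹ * G) * (X - Y)) =
      (Y - X) + star (Y - X) * ((1 + G * X)⁻¹ * G) * (Y - X) := by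
    rw [Matrix.star_eq_conjTranspose, conjTranspose_eq_of_nonneg hD]; noncomm_ring
  rw [h, add_smul, one_smul]
  set D := Y - X
  refine add_le_add le_rfl ?_
  have h1 : (1 + G * X)⁻¹ * G ≤ algebraMap ℝ _ ‖G‖ :=
    (inv_one_add_mul_mul_le hG hX).trans (IsSelfAdjoint.le_algebraMap_norm_self (.of_nonneg hG))
  refine (star_left_conjugate_le_conjugate h1 D).trans ?_
  have hS := CFC.sqrt_mul_sqrt_self D hD
  have hS0 : star (CFC.sqrt D) = CFC.sqrt D := (IsSelfAdjoint.of_nonneg (CFC.sqrt_nonneg D)).star_eq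
  have h2 := star_left_conjugate_le_conjugate
    (IsSelfAdjoint.le_algebraMap_norm_self (.of_nonneg hD)) (CFC.sqrt D)
  have h3 : D * D ≤ ‖D‖ • D := by
    have e1 : star (CFC.sqrt D) * D * CFC.sqrt D = D * D := by
      calc star (CFC.sqrt D) * D * CFC.sqrt D
          = CFC.sqrt D * (CFC.sqrt D * CFC.sqrt D) * CFC.sqrt D := by rw [hS0, hS]
        _ = (CFC.sqrt D * CFC.sqrt D) * (CFC.sqrt D * CFC.sqrt D) := by noncomm_ring
        _ = D * D := by rw [hS]
    have e2 : star (CFC.sqrt D) * (algebraMap ℝ _ ‖D‖) * CFC.sqrt D = ‖D‖ • D := by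
      rw [hS0, Algebra.algebraMap_eq_smul_one, mul_smul_comm, mul_one, smul_mul_assoc, hS]
    rwa [e1, e2] at h2
  have e3 : star D * (algebraMap ℝ _ ‖G‖) * D = ‖G‖ • (D * D) := by
    rw [Algebra.algebraMap_eq_smul_one, mul_smul_comm, mul_one, smul_mul_assoc,
      (IsSelfAdjoint.of_nonneg hD).star_eq]
  rw [e3, mul_smul]
  exact smul_le_smul_of_nonneg_left h3 (norm_nonneg _)

/-! ### The algorithm computes iterates of the Riccati operator -/

/-- The positive semidefiniteness of `G` and `H` that the algorithm preserves. -/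
def Triple.Nonneg (X : Triple n) : Prop := 0 ≤ X.G ∧ 0 ≤ X.H

/-- The Riccati operator with the coefficients of a triple. -/
noncomputable def Triple.map (X : Triple n) (Z : Matrix (Fin n) (Fin n) ℂ) :
    Matrix (Fin n) (Fin n) ℂ :=
  riccati X.A X.G X.H Z

lemma Triple.Nonneg.innerStep {X Y : Triple n} (hX : X.Nonneg) (hY : Y.Nonneg) :
    (innerStep X Y).Nonneg := by
  refine ⟨?_, ?_⟩
  · have h := star_right_conjugate_nonneg (inv_one_add_mul_mul_nonneg hX.1 hY.2) Y.A
    have h' := add_nonneg hY.1 h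
    simpa only [AFPI.innerStep, mul_assoc, Matrix.star_eq_conjTranspose] using h'
  · have h := riccati_nonneg (A := X.A) hX.1 hX.2 hY.2
    rw [riccati, add_comm] at h
    exact h

/-- One inner step is composition of the associated Riccati operators. -/
lemma map_innerStep {X Y : Triple n} (hX : X.Nonneg) (hY : Y.Nonneg)
    {Z : Matrix (Fin n) (Fin n) ℂ} (hZ : 0 ≤ Z) :
    (innerStep X Y).map Z = X.map (Y.map Z) := by
  have hU1 := mul_inv_one_add_mul hX.1 hY.2
  have hU2 := inv_one_add_mul_mul hX.1 hY.2
  have hV1 := mul_inv_one_add_mul hY.1 hZ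
  have hV2 := inv_one_add_mul_mul hY.1 hZ
  have hK0 : 0 ≤ Y.map Z := riccati_nonneg hY.1 hY.2 hZ
  have hP1 := mul_inv_one_add_mul hX.1 hK0
  have hQ2 := inv_one_add_mul_mul (hX.innerStep hY).1 hZ
  have hsub := mul_inv_one_add_mul_sub hX.1 hK0 hY.2
  have hUs := conjTranspose_inv_one_add_mul hX.1 hY.2
  obtain ⟨A₁, G₁, H₁⟩ := X
  obtain ⟨A₂, G₂, H₂⟩ := Y
  simp only [Triple.map, riccati, innerStep] at *
  rw [← hUs] at hsub
  set U := 1 + G₁ * H₂ with hU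
  set V := 1 + G₂ * Z with hV
  set K := A₂ᴴ * Z * V⁻¹ * A₂ with hK
  set P := 1 + G₁ * (K + H₂) with hP
  set Q := 1 + (G₂ + A₂ * U⁻¹ * G₁ * A₂ᴴ) * Z with hQ
  -- the push-through identity relating the two nested resolvents
  have key : V⁻¹ * A₂ * P⁻¹ = Q⁻¹ * A₂ * U⁻¹ := by
    have e : Q * V⁻¹ * A₂ = A₂ * U⁻¹ * P := by
      have e1 : Q = V + A₂ * U⁻¹ * G₁ * A₂ᴴ * Z := by rw [hQ, hV]; noncomm_ring
      have e2 : P = U + G₁ * K := by rw [hP, hU]; noncomm_ring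
      calc Q * V⁻¹ * A₂ = (V * V⁻¹) * A₂ + A₂ * U⁻¹ * G₁ * K := by
            rw [e1, hK]; noncomm_ring
        _ = A₂ * (U⁻¹ * U) + A₂ * U⁻¹ * G₁ * K := by rw [hV1, hU2, one_mul, mul_one]
        _ = _ := by rw [e2]; noncomm_ring
    calc V⁻¹ * A₂ * P⁻¹ = (Q⁻¹ * Q) * V⁻¹ * A₂ * P⁻¹ := by rw [hQ2, one_mul]
      _ = Q⁻¹ * (Q * V⁻¹ * A₂) * P⁻¹ := by noncomm_ring
      _ = Q⁻¹ * A₂ * U⁻¹ * (P * P⁻¹) := by rw [e]; noncomm_ring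
      _ = _ := by rw [hP1, mul_one]
  have hsub' : (K + H₂) * P⁻¹ = H₂ * U⁻¹ + (U⁻¹)ᴴ * K * P⁻¹ := by
    rw [add_sub_cancel_right] at hsub
    rw [← hsub]; abel
  have hA : (A₂ * U⁻¹ * A₁)ᴴ = A₁ᴴ * (U⁻¹)ᴴ * A₂ᴴ := by
    simp only [Matrix.conjTranspose_mul, mul_assoc]
  rw [hA]
  calc A₁ᴴ * (U⁻¹)ᴴ * A₂ᴴ * Z * Q⁻¹ * (A₂ * U⁻¹ * A₁) + (H₁ + A₁ᴴ * H₂ * U⁻¹ * A₁)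
      = A₁ᴴ * (U⁻¹)ᴴ * A₂ᴴ * Z * (Q⁻¹ * A₂ * U⁻¹) * A₁ + (H₁ + A₁ᴴ * H₂ * U⁻¹ * A₁) := by
        noncomm_ring
    _ = A₁ᴴ * (H₂ * U⁻¹ + (U⁻¹)ᴴ * K * P⁻¹) * A₁ + H₁ := by
        rw [← key, hK]; noncomm_ring
    _ = A₁ᴴ * (K + H₂) * P⁻¹ * A₁ + H₁ := by rw [← hsub']; noncomm_ring

lemma Triple.Nonneg.inner {X : Triple n} (hX : X.Nonneg) (j : ℕ) : (inner X j).Nonneg := by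
  induction j with
  | zero => exact hX
  | succ j ih => exact hX.innerStep ih

lemma Triple.Nonneg.outer {X : Triple n} (hX : X.Nonneg) (r k : ℕ) : (outer r X k).Nonneg := by
  induction k with
  | zero => exact hX
  | succ k ih => exact ih.inner _

lemma Triple.Nonneg.map_iterate {X : Triple n} (hX : X.Nonneg)
    {Z : Matrix (Fin n) (Fin n) ℂ} (hZ : 0 ≤ Z) (k : ℕ) : 0 ≤ X.map^[k] Z := by
  induction k with
  | zero => exact hZ
  | succ k ih =>
    rw [Function.iterate_succ_apply']
    exact riccati_nonneg hX.1 hX.2 ih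

lemma map_inner {X : Triple n} (hX : X.Nonneg) {Z : Matrix (Fin n) (Fin n) ℂ} (hZ : 0 ≤ Z)
    (j : ℕ) : (inner X j).map Z = X.map^[j + 1] Z := by
  induction j with
  | zero => rfl
  | succ j ih =>
    rw [inner, map_innerStep hX (hX.inner j) hZ, ih, ← Function.iterate_succ_apply' X.map]

/-- The `k`-th outer iterate represents `r ^ k` applications of the Riccati operator. -/
lemma map_outer {X : Triple n} (hX : X.Nonneg) {r : ℕ} (hr : 1 < r) (k : ℕ)
    {Z : Matrix (Fin n) (Fin n) ℂ} (hZ : 0 ≤ Z) : (outer r X k).map Z = X.map^[r ^ k] Z := by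
  induction k generalizing Z with
  | zero => simp [outer]
  | succ k ih =>
    rw [outer, map_inner (hX.outer r k) hZ, Nat.sub_add_cancel hr.le, pow_succ,
      Function.iterate_mul]
    have : ∀ i : ℕ, (AFPI.outer r X k).map^[i] Z = (X.map^[r ^ k])^[i] Z := by
      intro i
      induction i with
      | zero => rfl
      | succ i hi =>
        rw [Function.iterate_succ_apply', Function.iterate_succ_apply', ← hi,
          ih ((hX.outer r k).map_iterate hZ i)]
    exact this _

end Algebra

/-! ### Feedback matrices and completion of squares -/

section Feedback

variable {n m : ℕ} {A H X : Matrix (Fin n) (Fin n) ℂ} {B : Matrix (Fin n) (Fin m) ℂ}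
  {R : Matrix (Fin m) (Fin m) ℂ}

lemma gMat_nonneg (hR : R.PosDef) : 0 ≤ gMat B R :=
  Matrix.nonneg_iff_posSemidef.2 (hR.inv.posSemidef.mul_mul_conjTranspose_same B)

lemma posDef_add (hR : R.PosDef) (hX : 0 ≤ X) : (R + Bᴴ * X * B).PosDef :=
  hR.add_posSemidef ((Matrix.nonneg_iff_posSemidef.1 hX).conjTranspose_mul_mul_same B)

lemma mem_riccatiDom (hR : R.PosDef) (hX : 0 ≤ X) : X ∈ riccatiDom B R :=
  ⟨conjTranspose_eq_of_nonneg hX,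
    ((Matrix.isUnit_iff_isUnit_det _).1 (posDef_add hR hX).isUnit).ne_zero⟩

lemma weight_mul_feedback (hR : R.PosDef) (hX : 0 ≤ X) :
    (R + Bᴴ * X * B) * feedback A B R X = Bᴴ * X * A := by
  have hu := (Matrix.isUnit_iff_isUnit_det _).1 (posDef_add (B := B) hR hX).isUnit
  have e : feedback A B R X = (R + Bᴴ * X * B)⁻¹ * (Bᴴ * X * A) := by
    simp only [feedback, Matrix.mul_assoc]
  rw [e, Matrix.mul_nonsing_inv_cancel_left _ _ hu]

lemma closedLoop_eq (hR : R.PosDef) (hX : 0 ≤ X) :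
    closedLoop A B R X = (1 + gMat B R * X)⁻¹ * A := by
  have hRu : IsUnit R.det := (Matrix.isUnit_iff_isUnit_det _).1 hR.isUnit
  have h : (1 + gMat B R * X) * closedLoop A B R X = A := by
    have e : gMat B R * X * (B * feedback A B R X) + B * feedback A B R X =
        gMat B R * X * A := by
      calc gMat B R * X * (B * feedback A B R X) + B * feedback A B R X
          = B * (R⁻¹ * (Bᴴ * X * B * feedback A B R X) + feedback A B R X) := by
            simp only [gMat, Matrix.mul_assoc, Matrix.mul_add]
        _ = B * (R⁻¹ * ((R + Bᴴ * X * B) * feedback A B R X)) := by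
            rw [Matrix.add_mul R, Matrix.mul_add R⁻¹, Matrix.nonsing_inv_mul_cancel_left _ _ hRu,
              add_comm]
        _ = _ := by
            rw [weight_mul_feedback hR hX]
            simp only [gMat, Matrix.mul_assoc]
    rw [closedLoop, Matrix.add_mul, Matrix.one_mul, Matrix.mul_sub, ← e]
    abel
  calc closedLoop A B R X
      = (1 + gMat B R * X)⁻¹ * (1 + gMat B R * X) * closedLoop A B R X := by
        rw [inv_one_add_mul_mul (gMat_nonneg hR) hX, one_mul]
    _ = _ := by rw [mul_assoc, h]

/-- Completion of squares: among all feedback matrices `F` the matrix `feedback A B R X` minimizes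
`(A - B F)ᴴ X (A - B F) + Fᴴ R F`, and the minimal value is the Riccati operator. -/
lemma completion_of_squares (hR : R.PosDef) (hX : 0 ≤ X) (F : Matrix (Fin m) (Fin n) ℂ) :
    star (A - B * F) * X * (A - B * F) + (H + Fᴴ * R * F) - riccati A (gMat B R) H X =
      (F - feedback A B R X)ᴴ * (R + Bᴴ * X * B) * (F - feedback A B R X) := by
  have h1 := weight_mul_feedback (A := A) (B := B) hR hX
  have h2 : (feedback A B R X)ᴴ * (R + Bᴴ * X * B) = Aᴴ * X * B := by
    have := congrArg Matrix.conjTranspose h1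
    rw [Matrix.conjTranspose_mul, (posDef_add hR hX).isHermitian.eq] at this
    rw [this]
    simp [Matrix.conjTranspose_mul, conjTranspose_eq_of_nonneg hX, Matrix.mul_assoc]
  have h3 : riccati A (gMat B R) H X = Aᴴ * X * closedLoop A B R X + H := by
    rw [closedLoop_eq hR hX, riccati]; simp only [mul_assoc]
  have h4 : (F - feedback A B R X)ᴴ * (R + Bᴴ * X * B) * (F - feedback A B R X) =
      Fᴴ * (R + Bᴴ * X * B) * F - Fᴴ * (Bᴴ * X * A) - Aᴴ * X * B * F
        + Aᴴ * X * B * feedback A B R X := by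
    rw [Matrix.conjTranspose_sub, Matrix.sub_mul, h2, Matrix.mul_sub, Matrix.sub_mul,
      Matrix.sub_mul, Matrix.mul_assoc Fᴴ _ (feedback A B R X), h1]
    abel
  rw [h3, h4, closedLoop, Matrix.star_eq_conjTranspose]
  simp only [Matrix.conjTranspose_sub, Matrix.conjTranspose_mul, Matrix.sub_mul, Matrix.mul_sub,
    Matrix.mul_add, Matrix.add_mul, Matrix.mul_assoc]
  abel

lemma riccati_le_of_feedback (hR : R.PosDef) (hX : 0 ≤ X) (F : Matrix (Fin m) (Fin n) ℂ) :
    riccati A (gMat B R) H X ≤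
      star (A - B * F) * X * (A - B * F) + (H + Fᴴ * R * F) := by
  rw [← sub_nonneg, completion_of_squares hR hX, Matrix.nonneg_iff_posSemidef]
  exact (posDef_add hR hX).posSemidef.conjTranspose_mul_mul_same _

lemma riccati_eq_closedLoop (hR : R.PosDef) (hX : 0 ≤ X) :
    riccati A (gMat B R) H X =
      star (closedLoop A B R X) * X * closedLoop A B R X + hMat A B R H X := by
  have h := completion_of_squares (A := A) (H := H) (B := B) hR hX (feedback A B R X)
  rw [sub_self, Matrix.mul_zero, sub_eq_zero] at h
  exact h.symm

end Feedback

/-! ### Powers of a matrix and the Stein equation -/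

section Stein

variable {n : ℕ} {T X Q : Matrix (Fin n) (Fin n) ℂ}

lemma exists_norm_pow_le {t : NNReal} (ht : spectralRadius ℂ T < t) :
    ∃ c : ℝ, 1 ≤ c ∧ ∀ k : ℕ, ‖T ^ k‖ ≤ c * (t : ℝ) ^ k := by
  have h := (spectrum.pow_nnnorm_pow_one_div_tendsto_nhds_spectralRadius T).eventually_lt_const ht
  have ht0 : (0 : ℝ) < t := by
    have : (0 : ℝ≥0∞) < t := lt_of_le_of_lt bot_le ht
    exact_mod_cast this
  obtain ⟨N, hN⟩ := eventually_atTop.1 h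
  have hN' : ∀ k, N + 1 ≤ k → ‖T ^ k‖ ≤ (t : ℝ) ^ k := by
    intro k hk
    have h1 := hN k (by omega)
    have hk0 : (k : ℝ) ≠ 0 := by
      have : k ≠ 0 := by omega
      exact_mod_cast this
    have h2 := ENNReal.rpow_le_rpow h1.le (Nat.cast_nonneg (α := ℝ) k)
    rw [← ENNReal.rpow_mul, one_div_mul_cancel hk0, ENNReal.rpow_one, ENNReal.rpow_natCast] at h2
    exact_mod_cast h2
  refine ⟨1 + ∑ j ∈ Finset.range (N + 1), ‖T ^ j‖ / (t : ℝ) ^ j, ?_, fun k => ?_⟩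
  · exact le_add_of_nonneg_right (Finset.sum_nonneg fun j _ => by positivity)
  · by_cases hk : N + 1 ≤ k
    · refine (hN' k hk).trans (le_mul_of_one_le_left (by positivity) ?_)
      exact le_add_of_nonneg_right (Finset.sum_nonneg fun j _ => by positivity)
    · rw [← div_le_iff₀ (by positivity)]
      have := Finset.single_le_sum (f := fun j => ‖T ^ j‖ / (t : ℝ) ^ j)
        (fun j _ => by positivity) (Finset.mem_range.2 (not_le.1 hk))
      linarith

lemma tendsto_pow_zero (hT : spectralRadius ℂ T < 1) :
    Tendsto (fun k => T ^ k) atTop (𝓝 0) := by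
  obtain ⟨t, ht, ht1⟩ := ENNReal.lt_iff_exists_nnreal_btwn.1 hT
  obtain ⟨c, -, hc⟩ := exists_norm_pow_le ht
  refine squeeze_zero_norm hc ?_
  simpa using (tendsto_pow_atTop_nhds_zero_of_lt_one t.coe_nonneg
    (by exact_mod_cast ht1 : (t : ℝ) < 1)).const_mul c

lemma tendsto_conj_pow_zero (hT : spectralRadius ℂ T < 1) (X : Matrix (Fin n) (Fin n) ℂ) :
    Tendsto (fun k => star (T ^ k) * X * T ^ k) atTop (𝓝 0) := by
  have h := tendsto_pow_zero hT
  simpa using ((continuous_star.tendsto _).comp h |>.mul_const X).mul h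

lemma conj_pow_succ (T X : Matrix (Fin n) (Fin n) ℂ) (k : ℕ) :
    star (T ^ (k + 1)) * X * T ^ (k + 1) = star T * (star (T ^ k) * X * T ^ k) * T := by
  rw [pow_succ, star_mul]; noncomm_ring

lemma nonneg_of_conj_le (hT : spectralRadius ℂ T < 1) (h : star T * X * T ≤ X) : 0 ≤ X := by
  refine le_of_tendsto' (tendsto_conj_pow_zero hT X) fun k => ?_
  induction k with
  | zero => simp
  | succ k ih =>
    rw [conj_pow_succ]
    exact (star_left_conjugate_le_conjugate ih T).trans h

lemma stein_injective (hT : spectralRadius ℂ T < 1) {X Y : Matrix (Fin n) (Fin n) ℂ}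
    (h : stein T X = stein T Y) : X = Y := by
  have h' : star T * (X - Y) * T = X - Y := by
    simp only [stein] at h
    rw [Matrix.star_eq_conjTranspose, mul_sub, sub_mul]
    rw [sub_eq_sub_iff_sub_eq_sub] at h
    exact h.symm
  have e : ∀ k : ℕ, star (T ^ k) * (X - Y) * T ^ k = X - Y := by
    intro k
    induction k with
    | zero => simp
    | succ k ih => rw [conj_pow_succ, ih, h']
  have := tendsto_conj_pow_zero hT (X - Y)
  simp only [e] at this
  exact sub_eq_zero.1 (tendsto_nhds_unique tendsto_const_nhds this)

lemma exists_stein_eq (hT : spectralRadius ℂ T < 1) (Q : Matrix (Fin n) (Fin n) ℂ) :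
    ∃ X, stein T X = Q := by
  let f : Matrix (Fin n) (Fin n) ℂ →ₗ[ℂ] Matrix (Fin n) (Fin n) ℂ :=
    { toFun := stein T
      map_add' := fun X Y => by simp only [stein]; noncomm_ring
      map_smul' := fun c X => by simp [stein, smul_sub] }
  exact (LinearMap.injective_iff_surjective (f := f)).1 (fun _ _ h => stein_injective hT h) Q

/-- If `ρ(T) < 1`, the Stein equation with a Hermitian right-hand side has exactly one Hermitian
solution: the Stein operator is injective, hence bijective, and commutes with `ᴴ`. -/
lemma existsUnique_stein (hT : spectralRadius ℂ T < 1) (hQ : Qᴴ = Q) :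
    ∃! X : Matrix (Fin n) (Fin n) ℂ, X.IsHermitian ∧ stein T X = Q := by
  obtain ⟨X, hX⟩ := exists_stein_eq hT Q
  refine ⟨X, ⟨?_, hX⟩, fun Y hY => stein_injective hT (hY.2.trans hX.symm)⟩
  refine stein_injective hT ?_
  have := congrArg Matrix.conjTranspose hX
  rw [hQ] at this
  rw [hX, ← this]
  simp [stein, mul_assoc]

end Stein

/-! ### Monotone limits and root convergence -/

section Limits

variable {n : ℕ}

/-- A monotone sequence in a compact set of an ordered space converges, because its limit points
are least upper bounds. -/
lemma exists_tendsto_of_monotone {U : ℕ → Matrix (Fin n) (Fin n) ℂ} (hU : Monotone U)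
    {V : Matrix (Fin n) (Fin n) ℂ} (h0 : ∀ k, 0 ≤ U k) (hV : ∀ k, U k ≤ V) :
    ∃ L, Tendsto U atTop (𝓝 L) ∧ (∀ k, U k ≤ L) := by
  have hK : IsCompact (Metric.closedBall (0 : Matrix (Fin n) (Fin n) ℂ) ‖V‖) :=
    isCompact_closedBall _ _
  have hmem : ∀ k, U k ∈ Metric.closedBall (0 : Matrix (Fin n) (Fin n) ℂ) ‖V‖ := fun k => by
    rw [mem_closedBall_zero_iff]
    exact CStarAlgebra.norm_le_norm_of_nonneg_of_le (h0 k) (hV k)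
  obtain ⟨L, -, hL⟩ := hK.exists_mapClusterPt_of_frequently (l := atTop) (f := U)
    (Frequently.of_forall hmem)
  have hle : ∀ L, MapClusterPt L atTop U → ∀ k, U k ≤ L := fun L hL k =>
    isClosed_Ici.mem_of_mapClusterPt hL ((eventually_ge_atTop k).mono fun j hj => hU hj)
  refine ⟨L, hK.tendsto_nhds_of_unique_mapClusterPt (.of_forall hmem) fun L' _ hL' => ?_,
    hle L hL⟩
  exact le_antisymm
    (isClosed_Iic.mem_of_mapClusterPt hL' (.of_forall (hle L hL)))
    (isClosed_Iic.mem_of_mapClusterPt hL (.of_forall (hle L' hL')))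

lemma exists_tendsto_of_antitone {U : ℕ → Matrix (Fin n) (Fin n) ℂ} (hU : Antitone U)
    (h0 : ∀ k, 0 ≤ U k) : ∃ L, Tendsto U atTop (𝓝 L) ∧ (∀ k, L ≤ U k) := by
  obtain ⟨L, hL, hle⟩ := exists_tendsto_of_monotone (U := fun k => U 0 - U k) (V := U 0)
    (fun i j hij => sub_le_sub_left (hU hij) _) (fun k => sub_nonneg.2 (hU (Nat.zero_le k)))
    (fun k => sub_le_self _ (h0 k))
  refine ⟨U 0 - L, by simpa using hL.const_sub (U 0), fun k => ?_⟩
  have := hle k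
  rwa [sub_le_comm] at this

lemma continuousAt_riccati {A G H X : Matrix (Fin n) (Fin n) ℂ} (hG : 0 ≤ G) (hX : 0 ≤ X) :
    ContinuousAt (riccati A G H) X := by
  have h : ContinuousAt (fun Z : Matrix (Fin n) (Fin n) ℂ => (1 + G * Z)⁻¹) X := by
    simp only [Matrix.nonsing_inv_eq_ringInverse]
    obtain ⟨u, hu⟩ := isUnit_one_add_mul hG hX
    have h1 := NormedRing.inverse_continuousAt u
    rw [hu] at h1
    exact ContinuousAt.comp (f := fun Z => 1 + G * Z) (g := Ring.inverse) h1 (by fun_prop)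
  unfold riccati
  exact (((continuousAt_const.mul continuousAt_id).mul h).mul continuousAt_const).add
    continuousAt_const

/-- A limit of iterates of the Riccati operator is a fixed point. -/
lemma riccati_eq_of_tendsto {A G H X Z : Matrix (Fin n) (Fin n) ℂ} (hG : 0 ≤ G) (hX : 0 ≤ X)
    (h : Tendsto (fun k => (riccati A G H)^[k] Z) atTop (𝓝 X)) : X = riccati A G H X := by
  have h1 := (continuousAt_riccati (A := A) (H := H) hG hX).tendsto.comp h
  have h2 := h.comp (tendsto_add_atTop_nat 1)
  refine tendsto_nhds_unique h2 (h1.congr fun k => ?_)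
  simp [Function.iterate_succ_apply']

lemma rootLimsup_le {r : ℕ} (hr : 1 < r) {X : ℕ → Matrix (Fin n) (Fin n) ℂ}
    {L : Matrix (Fin n) (Fin n) ℂ} {c q : NNReal} (hc : c ≠ 0)
    (h : ∀ᶠ k in atTop, ‖X k - L‖ ≤ c * (q : ℝ) ^ (r ^ k)) : rootLimsup r X L ≤ q := by
  have hexp : Tendsto (fun k : ℕ => 1 / (r : ℝ) ^ k) atTop (𝓝 0) := by
    simpa using (tendsto_pow_atTop_nhds_zero_of_lt_one (r := ((r : ℝ))⁻¹) (by positivity)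
      (inv_lt_one_of_one_lt₀ (by exact_mod_cast hr)))
  have hlim : Tendsto (fun k : ℕ => ((c ^ (1 / (r : ℝ) ^ k) * q : NNReal) : ℝ≥0∞)) atTop
      (𝓝 q) := by
    rw [ENNReal.tendsto_coe]
    have h1 := (NNReal.continuousAt_rpow (x := c) (y := 0) (Or.inl hc)).tendsto.comp
      (tendsto_const_nhds.prodMk_nhds tendsto_id) |>.comp hexp
    simpa using h1.mul_const q
  rw [← hlim.limsup_eq]
  refine limsup_le_limsup (h.mono fun k hk => ?_)
  have hk' : ‖X k - L‖ₑ ≤ ((c * q ^ (r ^ k) : NNReal) : ℝ≥0∞) := by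
    rw [enorm_eq_nnnorm, ENNReal.coe_le_coe]
    exact_mod_cast hk
  have hr0 : (r : ℝ) ^ k ≠ 0 := by positivity
  calc ‖X k - L‖ₑ ^ (1 / (r : ℝ) ^ k)
      ≤ ((c * q ^ (r ^ k) : NNReal) : ℝ≥0∞) ^ (1 / (r : ℝ) ^ k) :=
        ENNReal.rpow_le_rpow hk' (by positivity)
    _ = _ := by
        rw [← ENNReal.coe_rpow_of_nonneg _ (by positivity), NNReal.mul_rpow,
          ← NNReal.rpow_natCast q, ← NNReal.rpow_mul, Nat.cast_pow, mul_one_div_cancel hr0,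
          NNReal.rpow_one]

/-- The constant `c` may depend on `t`: taking roots of order `r ^ k` removes it. -/
lemma rootLimsup_le_sq {r : ℕ} (hr : 1 < r) {X : ℕ → Matrix (Fin n) (Fin n) ℂ}
    {L : Matrix (Fin n) (Fin n) ℂ} {a : ℝ≥0∞}
    (h : ∀ t : NNReal, a < t → ∃ c : ℝ, ∀ᶠ k in atTop, ‖X k - L‖ ≤ c * ((t : ℝ) ^ 2) ^ (r ^ k)) :
    rootLimsup r X L ≤ a ^ 2 := by
  have key : ∀ t : NNReal, a < t → rootLimsup r X L ≤ (t : ℝ≥0∞) ^ 2 := by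
    intro t ht
    obtain ⟨c, hc⟩ := h t ht
    have hc0 : Real.toNNReal c + 1 ≠ 0 := by positivity
    have := rootLimsup_le hr (X := X) (L := L) (q := t ^ 2) hc0 (hc.mono fun k hk => hk.trans ?_)
    · simpa using this
    · push_cast
      gcongr
      exact (Real.le_coe_toNNReal c).trans (by simp)
  rcases eq_or_ne a ⊤ with rfl | ha
  · simp
  lift a to NNReal using ha
  have hlim : Tendsto (fun t : NNReal => (t : ℝ≥0∞) ^ 2) (𝓝[>] a) (𝓝 ((a : ℝ≥0∞) ^ 2)) := by
    have : Continuous fun t : NNReal => ((t ^ 2 : NNReal) : ℝ≥0∞) := by fun_prop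
    have h2 := this.tendsto a
    simp only [ENNReal.coe_pow] at h2
    exact h2.mono_left nhdsWithin_le_nhds
  refine ge_of_tendsto hlim ?_
  filter_upwards [self_mem_nhdsWithin] with t ht
  exact key t (by exact_mod_cast ht)

lemma convergesRSuperlinearly_of_le {r : ℕ} (hr : 1 < r) {X : ℕ → Matrix (Fin n) (Fin n) ℂ}
    {L : Matrix (Fin n) (Fin n) ℂ} {a : ℝ≥0∞} (h : rootLimsup r X L ≤ a) (ha : a < 1) :
    ConvergesRSuperlinearly r X L := by
  obtain ⟨s, hs, hs1⟩ := ENNReal.lt_iff_exists_nnreal_btwn.1 ha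
  refine ⟨hr, s, ?_, by exact_mod_cast hs1, ?_⟩
  · have : (0 : ℝ≥0∞) < s := lt_of_le_of_lt bot_le hs
    exact_mod_cast this
  · rw [ENNReal.ofReal_coe_nnreal]
    exact h.trans hs.le

lemma rhoDisk_lt_one (M : Matrix (Fin n) (Fin n) ℂ) : rhoDisk M < 1 := by
  have hfin : (spectrum ℂ M ∩ Metric.ball (0 : ℂ) 1).Finite :=
    (Matrix.finite_spectrum M).inter_of_left _
  rw [rhoDisk, ← sSup_image]
  rcases (spectrum ℂ M ∩ Metric.ball (0 : ℂ) 1).eq_empty_or_nonempty with h | h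
  · simp [h]
  rw [(hfin.image _).csSup_lt_iff (h.image _)]
  rintro _ ⟨z, ⟨-, hz⟩, rfl⟩
  rw [mem_ball_zero_iff] at hz
  rw [← ofReal_norm, ENNReal.ofReal_lt_one]
  exact hz

end Limits

/-! ### Decay of `P Tᵏ` governed by the eigenvalues of `T` in the open unit disk -/

section Decay

variable {n : ℕ} {T P : Matrix (Fin n) (Fin n) ℂ}

lemma mulVec_eq_zero_of_le {X : Matrix (Fin n) (Fin n) ℂ} (hX : 0 ≤ X) (hXP : X ≤ P)
    {x : Fin n → ℂ} (hx : P *ᵥ x = 0) : X *ᵥ x = 0 := by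
  have hX' := Matrix.nonneg_iff_posSemidef.1 hX
  rw [← hX'.dotProduct_mulVec_zero_iff]
  refine le_antisymm ?_ (hX'.dotProduct_mulVec_nonneg x)
  have := (Matrix.le_iff.1 hXP).dotProduct_mulVec_nonneg x
  rw [Matrix.sub_mulVec, hx] at this
  simpa using this

lemma dotProduct_conj_mulVec (x : Fin n → ℂ) :
    star x ⬝ᵥ (star T * P * T) *ᵥ x = star (T *ᵥ x) ⬝ᵥ P *ᵥ (T *ᵥ x) := by
  rw [Matrix.star_mulVec, ← Matrix.dotProduct_mulVec, Matrix.mulVec_mulVec, Matrix.mulVec_mulVec,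
    Matrix.star_eq_conjTranspose, mul_assoc]

lemma mulVec_mulVec_eq_zero (hP : 0 ≤ P) (hT : star T * P * T ≤ P) {x : Fin n → ℂ}
    (hx : P *ᵥ x = 0) : P *ᵥ (T *ᵥ x) = 0 := by
  have h := mulVec_eq_zero_of_le (star_left_conjugate_nonneg hP T) hT hx
  rw [← (Matrix.nonneg_iff_posSemidef.1 hP).dotProduct_mulVec_zero_iff, ← dotProduct_conj_mulVec, h]
  simp

lemma exists_generalized_inverse (hP : 0 ≤ P) : ∃ J : Matrix (Fin n) (Fin n) ℂ, P * J * P = P := by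
  have hsa : IsSelfAdjoint P := .of_nonneg hP
  have hc : ∀ f : ℝ → ℝ, ContinuousOn f (spectrum ℝ P) := fun f =>
    (Matrix.finite_real_spectrum (A := P)).continuousOn f
  refine ⟨cfc (fun x : ℝ => x⁻¹) P, ?_⟩
  have h1 := cfc_mul (fun x : ℝ => x * x⁻¹) (fun x => x) P (hc _) (hc _)
  have h2 := cfc_mul (fun x : ℝ => x) (fun x => x⁻¹) P (hc _) (hc _)
  rw [cfc_id' ℝ P] at h1 h2
  rw [← h2, ← h1]
  simp only [mul_inv_mul_cancel]
  exact cfc_id' ℝ P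

lemma mem_spectrum_iff_det {M : Matrix (Fin n) (Fin n) ℂ} {z : ℂ} :
    z ∈ spectrum ℂ M ↔ (z • (1 : Matrix (Fin n) (Fin n) ℂ) - M).det = 0 := by
  rw [spectrum.mem_iff, Matrix.isUnit_iff_isUnit_det, isUnit_iff_ne_zero, not_not,
    Algebra.algebraMap_eq_smul_one]

/-- By `Tᴴ P T ≤ P` the kernel of `P` is `T`-invariant, so `P T = L P` for a matrix `L`, which
represents the action of `T` modulo that kernel. Each nonzero eigenvalue of `L` is an eigenvalue of `T`, and
one outside the open unit disk is excluded: outside the closed disk by `Tᴴ P T ≤ P`, on the unit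
circle by the hypothesis `hker`. Gelfand's formula for `L` then bounds `P Tᵏ = Lᵏ P`. -/
lemma exists_norm_conj_pow_le (hP : 0 ≤ P) (hT : star T * P * T ≤ P)
    (hker : ∀ (x : Fin n → ℂ) (z : ℂ), ‖z‖ = 1 → P *ᵥ (T *ᵥ x - z • x) = 0 → P *ᵥ x = 0)
    {t : NNReal} (ht : rhoDisk T < t) :
    ∃ c : ℝ, ∀ k : ℕ, ‖star (T ^ k) * P * T ^ k‖ ≤ c * ((t : ℝ) ^ 2) ^ k := by
  obtain ⟨J, hJ⟩ := exists_generalized_inverse hP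
  set L := P * T * J with hL
  have hLP : L * P = P * T := by
    rw [← sub_eq_zero]
    refine Matrix.ext_of_mulVec_single fun i => ?_
    set e : Fin n → ℂ := Pi.single i 1
    have h1 : P *ᵥ ((J * P - 1) *ᵥ e) = 0 := by
      rw [Matrix.mulVec_mulVec, mul_sub, mul_one, ← mul_assoc, hJ, sub_self, Matrix.zero_mulVec]
    have h2 := mulVec_mulVec_eq_zero hP hT h1
    rw [Matrix.mulVec_mulVec, Matrix.mulVec_mulVec] at h2
    rw [Matrix.zero_mulVec, ← h2]
    congr 1
    rw [hL]; noncomm_ring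
  have hspec : spectralRadius ℂ L ≤ rhoDisk T := by
    refine iSup₂_le fun z hz => ?_
    rcases eq_or_ne z 0 with rfl | hz0
    · simp
    have hzT : z ∈ spectrum ℂ T := by
      -- a left eigenvector `v` of `L` yields the left eigenvector `v P` of `T`
      obtain ⟨v, hv0, hv⟩ := Matrix.exists_vecMul_eq_zero_iff.2 (mem_spectrum_iff_det.1 hz)
      rw [mem_spectrum_iff_det, ← Matrix.exists_vecMul_eq_zero_iff]
      rw [Matrix.vecMul_sub, Matrix.vecMul_smul, Matrix.vecMul_one, sub_eq_zero] at hv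
      refine ⟨v ᵥ* P, fun h0 => hv0 ?_, ?_⟩
      · have h1 : v ᵥ* L = 0 := by
          rw [hL, ← Matrix.vecMul_vecMul, ← Matrix.vecMul_vecMul, h0, Matrix.zero_vecMul,
            Matrix.zero_vecMul]
        exact (smul_eq_zero.1 (hv.trans h1)).resolve_left hz0
      · rw [Matrix.vecMul_sub, Matrix.vecMul_smul, Matrix.vecMul_one, Matrix.vecMul_vecMul, ← hLP,
          ← Matrix.vecMul_vecMul, ← hv, Matrix.smul_vecMul, sub_self]
    have hz1 : ‖z‖ < 1 := by
      -- a right eigenvector of `L` has the form `P x`, and `x` is an eigenvector of `T`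
      -- modulo the kernel of `P`
      obtain ⟨w, hw0, hw⟩ := Matrix.exists_mulVec_eq_zero_iff.2 (mem_spectrum_iff_det.1 hz)
      rw [Matrix.sub_mulVec, Matrix.smul_mulVec, Matrix.one_mulVec, sub_eq_zero] at hw
      set x : Fin n → ℂ := z⁻¹ • ((T * J) *ᵥ w) with hx
      have hPx : P *ᵥ x = w := by
        rw [hx, Matrix.mulVec_smul, Matrix.mulVec_mulVec, ← mul_assoc, ← hL, ← hw,
          inv_smul_smul₀ hz0]
      have hPTx : P *ᵥ (T *ᵥ x) = z • P *ᵥ x := by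
        rw [Matrix.mulVec_mulVec, ← hLP, ← Matrix.mulVec_mulVec, hPx, hw]
      have hq : star x ⬝ᵥ (star T * P * T) *ᵥ x = ((‖z‖ ^ 2 : ℝ) : ℂ) * (star x ⬝ᵥ P *ᵥ x) := by
        have hPs := conjTranspose_eq_of_nonneg hP
        have e1 : star (T *ᵥ x) ⬝ᵥ P *ᵥ x = star z * (star x ⬝ᵥ P *ᵥ x) := by
          calc star (T *ᵥ x) ⬝ᵥ P *ᵥ x = star (P *ᵥ (T *ᵥ x)) ⬝ᵥ x := by
                rw [Matrix.star_mulVec P, hPs, ← Matrix.dotProduct_mulVec]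
            _ = _ := by
                rw [hPTx, star_smul, smul_dotProduct, Matrix.star_mulVec, hPs,
                  ← Matrix.dotProduct_mulVec, smul_eq_mul]
        rw [dotProduct_conj_mulVec, hPTx, dotProduct_smul, e1, smul_eq_mul, ← mul_assoc]
        congr 1
        rw [Complex.star_def, Complex.mul_conj, Complex.normSq_eq_norm_sq]
      have hpos := (Matrix.nonneg_iff_posSemidef.1 hP).dotProduct_mulVec_nonneg x
      have hne : star x ⬝ᵥ P *ᵥ x ≠ 0 := by
        rw [Ne, (Matrix.nonneg_iff_posSemidef.1 hP).dotProduct_mulVec_zero_iff, hPx]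
        exact hw0
      have hle := (Matrix.le_iff.1 hT).dotProduct_mulVec_nonneg x
      rw [Matrix.sub_mulVec, dotProduct_sub, hq] at hle
      obtain ⟨a, ha⟩ : ∃ a : ℝ, (a : ℂ) = star x ⬝ᵥ P *ᵥ x :=
        ⟨_, (Complex.eq_re_of_ofReal_le hpos).symm⟩
      rw [← ha] at hpos hne hle
      norm_cast at hpos hne hle
      have ha0 : 0 < a := lt_of_le_of_ne hpos (Ne.symm hne)
      have hz2 : ‖z‖ ≤ 1 := by
        by_contra! h
        nlinarith [one_lt_pow₀ h two_ne_zero]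
      refine lt_of_le_of_ne hz2 fun h1 => hw0 ?_
      rw [← hPx]
      refine hker x z h1 ?_
      rw [Matrix.mulVec_sub, hPTx, Matrix.mulVec_smul P z x, sub_self]
    exact le_iSup₂ (f := fun (z : ℂ) (_ : z ∈ spectrum ℂ T ∩ Metric.ball (0 : ℂ) 1) => ‖z‖ₑ) z
      ⟨hzT, by simpa using hz1⟩
  obtain ⟨c, -, hc⟩ := exists_norm_pow_le (hspec.trans_lt ht)
  have hpow : ∀ k : ℕ, P * T ^ k = L ^ k * P := by
    intro k
    induction k with
    | zero => simp
    | succ k ih => rw [pow_succ, ← mul_assoc, ih, mul_assoc, ← hLP, ← mul_assoc, ← pow_succ]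
  refine ⟨‖P‖ * c * ‖J‖ * (c * ‖P‖), fun k => ?_⟩
  have e : star (T ^ k) * P * T ^ k = star (L ^ k * P) * J * (L ^ k * P) := by
    rw [← hpow, star_mul, (IsSelfAdjoint.of_nonneg hP).star_eq]
    nth_rw 1 [← hJ]
    noncomm_ring
  have h1 : ‖L ^ k * P‖ ≤ c * (t : ℝ) ^ k * ‖P‖ :=
    (norm_mul_le _ _).trans (mul_le_mul_of_nonneg_right (hc k) (norm_nonneg _))
  have h0 : 0 ≤ c * (t : ℝ) ^ k * ‖P‖ := (norm_nonneg _).trans h1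
  rw [e]
  calc ‖star (L ^ k * P) * J * (L ^ k * P)‖
      ≤ ‖L ^ k * P‖ * ‖J‖ * ‖L ^ k * P‖ := by
        refine (norm_mul_le _ _).trans (mul_le_mul_of_nonneg_right ?_ (norm_nonneg _))
        exact (norm_mul_le _ _).trans (by rw [norm_star])
    _ ≤ (c * (t : ℝ) ^ k * ‖P‖) * ‖J‖ * (c * (t : ℝ) ^ k * ‖P‖) := by gcongr
    _ = _ := by ring

end Decay

/-! ### Rates of convergence -/

section Rates

variable {n : ℕ} {T P : Matrix (Fin n) (Fin n) ℂ}

/-- If the growth factors `1 + a k` tend to `1`, their products grow slower than any geometric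
sequence with ratio larger than `1`. -/
lemma exists_prod_le {a : ℕ → ℝ} (ha0 : ∀ k, 0 ≤ a k) (ha : Tendsto a atTop (𝓝 0)) {b : ℝ}
    (hb : 1 < b) : ∃ c : ℝ, ∀ k, ∏ j ∈ Finset.range k, (1 + a j) ≤ c * b ^ k := by
  obtain ⟨N, hN⟩ := eventually_atTop.1 (ha.eventually_le_const (sub_pos.2 hb))
  have hp : ∀ k, 0 ≤ ∏ j ∈ Finset.range k, (1 + a j) := fun k =>
    Finset.prod_nonneg fun j _ => by linarith [ha0 j]
  set c := ∑ i ∈ Finset.range (N + 1), ∏ j ∈ Finset.range i, (1 + a j)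
  have hc : ∀ k ≤ N, ∏ j ∈ Finset.range k, (1 + a j) ≤ c := fun k hk =>
    Finset.single_le_sum (f := fun i => ∏ j ∈ Finset.range i, (1 + a j)) (fun i _ => hp i)
      (Finset.mem_range.2 (by omega))
  have hc0 : 0 ≤ c := (hp 0).trans (hc 0 (Nat.zero_le _))
  refine ⟨c, fun k => ?_⟩
  rcases le_total k N with hk | hk
  · exact (hc k hk).trans (le_mul_of_one_le_right hc0 (one_le_pow₀ hb.le))
  · induction k, hk using Nat.le_induction with
    | base => exact (hc N le_rfl).trans (le_mul_of_one_le_right hc0 (one_le_pow₀ hb.le))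
    | succ k hk ih =>
      rw [Finset.prod_range_succ, pow_succ, ← mul_assoc]
      exact mul_le_mul ih (by linarith [hN k hk]) (by linarith [ha0 k]) (by positivity)

/-- The factors `1 + g ‖D k‖` tend to `1`, so they cost only the passage from `s` to a larger `t`. -/
lemma exists_norm_le_of_conj_smul_le {D : ℕ → Matrix (Fin n) (Fin n) ℂ} {g : ℝ} (hg : 0 ≤ g)
    (hD0 : ∀ k, 0 ≤ D k) (hD : Tendsto D atTop (𝓝 0))
    (hstep : ∀ k, D (k + 1) ≤ (1 + g * ‖D k‖) • (star T * D k * T))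
    {s t : NNReal} (hs : 0 < s) (hst : s < t) {c : ℝ}
    (hc : ∀ k : ℕ, ‖star (T ^ k) * D 0 * T ^ k‖ ≤ c * ((s : ℝ) ^ 2) ^ k) :
    ∃ c' : ℝ, ∀ k, ‖D k‖ ≤ c' * ((t : ℝ) ^ 2) ^ k := by
  have hs' : (0 : ℝ) < (s : ℝ) ^ 2 := by positivity
  have hb : 1 < (t : ℝ) ^ 2 / (s : ℝ) ^ 2 := by
    rw [one_lt_div hs']
    exact pow_lt_pow_left₀ (by exact_mod_cast hst) s.coe_nonneg two_ne_zero
  obtain ⟨d, hd⟩ := exists_prod_le (a := fun k => g * ‖D k‖) (fun k => by positivity)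
    (by simpa using hD.norm.const_mul g) hb
  set p : ℕ → ℝ := fun k => ∏ j ∈ Finset.range k, (1 + g * ‖D j‖)
  have hp : ∀ k, 0 ≤ p k := fun k => Finset.prod_nonneg fun j _ => by positivity
  have hbound : ∀ k, D k ≤ p k • (star (T ^ k) * D 0 * T ^ k) := by
    intro k
    induction k with
    | zero => simp [p]
    | succ k ih =>
      refine (hstep k).trans ?_
      have h1 := star_left_conjugate_le_conjugate ih T
      rw [mul_smul_comm, smul_mul_assoc, ← conj_pow_succ] at h1
      refine (smul_le_smul_of_nonneg_left h1 (by positivity)).trans_eq ?_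
      rw [smul_smul]
      simp only [p, Finset.prod_range_succ, mul_comm]
  refine ⟨d * c, fun k => ?_⟩
  calc ‖D k‖ ≤ ‖p k • (star (T ^ k) * D 0 * T ^ k)‖ :=
        CStarAlgebra.norm_le_norm_of_nonneg_of_le (hD0 k) (hbound k)
    _ = p k * ‖star (T ^ k) * D 0 * T ^ k‖ := by rw [norm_smul, Real.norm_of_nonneg (hp k)]
    _ ≤ (d * ((t : ℝ) ^ 2 / (s : ℝ) ^ 2) ^ k) * (c * ((s : ℝ) ^ 2) ^ k) :=
        mul_le_mul (hd k) (hc k) (norm_nonneg _) ((hp k).trans (hd k))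
    _ = d * c * (((t : ℝ) ^ 2 / (s : ℝ) ^ 2) * (s : ℝ) ^ 2) ^ k := by rw [mul_pow]; ring
    _ = _ := by rw [div_mul_cancel₀ _ hs'.ne']

lemma exists_norm_le_of_conj_le {E : ℕ → Matrix (Fin n) (Fin n) ℂ} (hE0 : ∀ k, 0 ≤ E k)
    (hstep : ∀ k, E (k + 1) ≤ star T * E k * T) {t : NNReal} (ht : spectralRadius ℂ T < t) :
    ∃ c : ℝ, ∀ k, ‖E k‖ ≤ c * ((t : ℝ) ^ 2) ^ k := by
  obtain ⟨c, hc1, hc⟩ := exists_norm_pow_le ht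
  have hbound : ∀ k, E k ≤ star (T ^ k) * E 0 * T ^ k := by
    intro k
    induction k with
    | zero => simp
    | succ k ih =>
      rw [conj_pow_succ]
      exact (hstep k).trans (star_left_conjugate_le_conjugate ih T)
  refine ⟨c * ‖E 0‖ * c, fun k => ?_⟩
  calc ‖E k‖ ≤ ‖star (T ^ k) * E 0 * T ^ k‖ :=
        CStarAlgebra.norm_le_norm_of_nonneg_of_le (hE0 k) (hbound k)
    _ ≤ ‖T ^ k‖ * ‖E 0‖ * ‖T ^ k‖ := by
        refine (norm_mul_le _ _).trans (mul_le_mul_of_nonneg_right ?_ (norm_nonneg _))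
        exact (norm_mul_le _ _).trans (by rw [norm_star])
    _ ≤ (c * (t : ℝ) ^ k) * ‖E 0‖ * (c * (t : ℝ) ^ k) := by
        have := hc k
        gcongr
    _ = _ := by ring

end Rates

/-! ### The minimal solution has no unit eigenvalues modulo its kernel -/

section Minimal

variable {n m : ℕ} {A H P : Matrix (Fin n) (Fin n) ℂ} {B : Matrix (Fin n) (Fin m) ℂ}
  {R : Matrix (Fin m) (Fin m) ℂ}

lemma conj_closedLoop_le (hR : R.PosDef) (hH : 0 ≤ H) (hP : 0 ≤ P)
    (hfix : P = riccati A (gMat B R) H P) :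
    star (closedLoop A B R P) * P * closedLoop A B R P ≤ P := by
  have h := riccati_eq_closedLoop (A := A) (H := H) (B := B) hR hP
  rw [← hfix] at h
  conv_rhs => rw [h]
  refine le_add_of_nonneg_right (add_nonneg hH (Matrix.nonneg_iff_posSemidef.2 ?_))
  exact hR.posSemidef.conjTranspose_mul_mul_same _

/-- If `x` is modulo `ker P` an eigenvector of the closed-loop matrix for an eigenvalue of modulus
`1`, then `x` costs nothing: neither the feedback nor `H` sees it. The control `0` then shows that
the quadratic forms of the Riccati iterates started at `0` vanish at `x`, and so does their
limit. -/
lemma mulVec_eq_zero_of_unit_eigenvalue (hR : R.PosDef) (hH : 0 ≤ H) (hP : 0 ≤ P)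
    (hfix : P = riccati A (gMat B R) H P)
    (hle : ∀ k, (riccati A (gMat B R) H)^[k] 0 ≤ P)
    (hlim : Tendsto (fun k => (riccati A (gMat B R) H)^[k] 0) atTop (𝓝 P))
    (x : Fin n → ℂ) (z : ℂ) (hz : ‖z‖ = 1)
    (hx : P *ᵥ (closedLoop A B R P *ᵥ x - z • x) = 0) : P *ᵥ x = 0 := by
  have hG : 0 ≤ gMat B R := gMat_nonneg hR
  have hPs := Matrix.nonneg_iff_posSemidef.1 hP
  have hHs := Matrix.nonneg_iff_posSemidef.1 hH
  set T := closedLoop A B R P with hT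
  set F := feedback A B R P with hF
  have hFs := hR.posSemidef.conjTranspose_mul_mul_same F
  have hzz : star z * z = 1 := by
    rw [Complex.star_def, mul_comm, Complex.mul_conj, Complex.normSq_eq_norm_sq, hz]; simp
  -- a Hermitian form that vanishes at `T x - z x` takes the same value at `T x` and at `x`
  have hform : ∀ Z : Matrix (Fin n) (Fin n) ℂ, 0 ≤ Z → Z ≤ P →
      star (T *ᵥ x) ⬝ᵥ Z *ᵥ (T *ᵥ x) = star x ⬝ᵥ Z *ᵥ x := by
    intro Z hZ hZP
    have h0 := mulVec_eq_zero_of_le hZ hZP hx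
    rw [Matrix.mulVec_sub, Matrix.mulVec_smul, sub_eq_zero] at h0
    have hZs := conjTranspose_eq_of_nonneg hZ
    have e1 : star (T *ᵥ x) ⬝ᵥ Z *ᵥ x = star z * (star x ⬝ᵥ Z *ᵥ x) := by
      calc star (T *ᵥ x) ⬝ᵥ Z *ᵥ x = star (Z *ᵥ (T *ᵥ x)) ⬝ᵥ x := by
            rw [Matrix.star_mulVec Z, hZs, ← Matrix.dotProduct_mulVec]
        _ = _ := by
            rw [h0, star_smul, smul_dotProduct, Matrix.star_mulVec, hZs,
              ← Matrix.dotProduct_mulVec, smul_eq_mul]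
    rw [h0, dotProduct_smul, e1, smul_eq_mul, ← mul_assoc, mul_comm z, hzz, one_mul]
  have hcost : star x ⬝ᵥ H *ᵥ x + star x ⬝ᵥ (Fᴴ * R * F) *ᵥ x = 0 := by
    have h := riccati_eq_closedLoop (A := A) (H := H) (B := B) hR hP
    rw [← hfix] at h
    have h' := congrArg (fun Z => star x ⬝ᵥ Z *ᵥ x) h
    simp only [Matrix.add_mulVec, dotProduct_add, hMat] at h'
    rw [dotProduct_conj_mulVec, hform P hP le_rfl] at h'
    exact left_eq_add.1 h'
  obtain ⟨hHx, hFx⟩ := (add_eq_zero_iff_of_nonneg (hHs.dotProduct_mulVec_nonneg x)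
    (hFs.dotProduct_mulVec_nonneg x)).1 hcost
  have hFx0 : F *ᵥ x = 0 := by
    by_contra hne
    have := hR.dotProduct_mulVec_pos hne
    rw [Matrix.star_mulVec, ← Matrix.dotProduct_mulVec, Matrix.mulVec_mulVec, Matrix.mulVec_mulVec,
      hFx] at this
    exact lt_irrefl _ this
  have hAx : A *ᵥ x = T *ᵥ x := by
    rw [hT, closedLoop, Matrix.sub_mulVec, ← Matrix.mulVec_mulVec, hFx0, Matrix.mulVec_zero,
      sub_zero]
  have hzero : ∀ k, star x ⬝ᵥ ((riccati A (gMat B R) H)^[k] 0) *ᵥ x = 0 := by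
    intro k
    have hnn : ∀ k, 0 ≤ (riccati A (gMat B R) H)^[k] 0 := fun k =>
      Triple.Nonneg.map_iterate (X := ⟨A, gMat B R, H⟩) ⟨hG, hH⟩ le_rfl k
    induction k with
    | zero => simp
    | succ k ih =>
      refine le_antisymm ?_
        ((Matrix.nonneg_iff_posSemidef.1 (hnn (k + 1))).dotProduct_mulVec_nonneg x)
      rw [Function.iterate_succ_apply']
      have h := riccati_le_of_feedback (A := A) (H := H) (B := B) hR (hnn k) 0
      have h' := (Matrix.le_iff.1 h).dotProduct_mulVec_nonneg x
      simp only [Matrix.mul_zero, sub_zero, add_zero] at h'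
      rw [Matrix.sub_mulVec, dotProduct_sub, Matrix.add_mulVec, dotProduct_add,
        dotProduct_conj_mulVec, hAx, hform _ (hnn k) (hle k), ih, hHx, add_zero, zero_sub] at h'
      exact neg_nonneg.1 h'
  rw [← hPs.dotProduct_mulVec_zero_iff]
  have hcont : Continuous fun Z : Matrix (Fin n) (Fin n) ℂ => star x ⬝ᵥ Z *ᵥ x := by fun_prop
  have h := (hcont.tendsto P).comp hlim
  refine tendsto_nhds_unique h ?_
  simp only [Function.comp_def, hzero]
  exact tendsto_const_nhds

end Minimal

/-! ### Existence of the extremal solutions and convergence of the iterates -/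

section Solutions

variable {n m : ℕ} {A H X Y Xs : Matrix (Fin n) (Fin n) ℂ} {B : Matrix (Fin n) (Fin m) ℂ}
  {R : Matrix (Fin m) (Fin m) ℂ}

lemma hMat_nonneg (hR : R.PosDef) (hH : 0 ≤ H) : 0 ≤ hMat A B R H Xs :=
  add_nonneg hH (Matrix.nonneg_iff_posSemidef.2 (hR.posSemidef.conjTranspose_mul_mul_same _))

lemma stein_eq_iff {T Q : Matrix (Fin n) (Fin n) ℂ} :
    stein T X = Q ↔ X = star T * X * T + Q := by
  rw [stein, Matrix.star_eq_conjTranspose, sub_eq_iff_eq_add']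

lemma nonneg_of_stein_eq (hR : R.PosDef) (hH : 0 ≤ H)
    (hρ : spectralRadius ℂ (closedLoop A B R Xs) < 1)
    (hX : stein (closedLoop A B R Xs) X = hMat A B R H Xs) : 0 ≤ X := by
  refine nonneg_of_conj_le hρ ?_
  conv_rhs => rw [stein_eq_iff.1 hX]
  exact le_add_of_nonneg_right (hMat_nonneg hR hH)

lemma riccati_le_of_stein_eq (hR : R.PosDef) (hX0 : 0 ≤ X)
    (hX : stein (closedLoop A B R Xs) X = hMat A B R H Xs) :
    riccati A (gMat B R) H X ≤ X := by
  conv_rhs => rw [stein_eq_iff.1 hX]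
  exact riccati_le_of_feedback hR hX0 _

/-- The solution of the Stein equation of any stabilizing feedback dominates every positive
semidefinite solution `Y` of the Riccati equation: by optimality of the feedback of `Y`,
the difference satisfies a Stein inequality. -/
lemma le_of_stein_eq (hR : R.PosDef) (hρ : spectralRadius ℂ (closedLoop A B R Xs) < 1)
    (hX : stein (closedLoop A B R Xs) X = hMat A B R H Xs)
    (hY0 : 0 ≤ Y) (hY : Y = riccati A (gMat B R) H Y) : Y ≤ X := by
  rw [← sub_nonneg]
  refine nonneg_of_conj_le hρ ?_
  have h := riccati_le_of_feedback (A := A) (H := H) (B := B) hR hY0 (feedback A B R Xs)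
  rw [← hY] at h
  rw [mul_sub, sub_mul, le_sub_iff_add_le, sub_add_eq_add_sub, sub_le_iff_le_add]
  conv_rhs => rw [stein_eq_iff.1 hX]
  rw [add_assoc, add_comm (hMat A B R H Xs)]
  refine add_le_add le_rfl (h.trans_eq ?_)
  rfl

lemma iterate_riccati_nonneg {G Z : Matrix (Fin n) (Fin n) ℂ} (hG : 0 ≤ G) (hH : 0 ≤ H)
    (hZ : 0 ≤ Z) (k : ℕ) : 0 ≤ (riccati A G H)^[k] Z :=
  Triple.Nonneg.map_iterate (X := ⟨A, G, H⟩) ⟨hG, hH⟩ hZ k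

lemma iterate_riccati_le {G Z : Matrix (Fin n) (Fin n) ℂ} (hG : 0 ≤ G) (hH : 0 ≤ H)
    (hZ : 0 ≤ Z) (hZX : Z ≤ X) (hX : riccati A G H X ≤ X) (k : ℕ) :
    (riccati A G H)^[k] Z ≤ X := by
  induction k with
  | zero => exact hZX
  | succ k ih =>
    rw [Function.iterate_succ_apply']
    exact (riccati_mono hG (iterate_riccati_nonneg hG hH hZ k) ih).trans hX

lemma le_iterate_riccati {G Z : Matrix (Fin n) (Fin n) ℂ} (hG : 0 ≤ G)
    (hY : 0 ≤ Y) (hYZ : Y ≤ Z) (hfix : Y = riccati A G H Y) (k : ℕ) :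
    Y ≤ (riccati A G H)^[k] Z := by
  induction k with
  | zero => exact hYZ
  | succ k ih =>
    rw [Function.iterate_succ_apply', hfix]
    exact riccati_mono hG hY ih

lemma monotone_iterate_riccati {G : Matrix (Fin n) (Fin n) ℂ} (hG : 0 ≤ G) (hH : 0 ≤ H) :
    Monotone fun k => (riccati A G H)^[k] 0 := by
  refine monotone_nat_of_le_succ fun k => ?_
  induction k with
  | zero => exact iterate_riccati_nonneg hG hH le_rfl 1
  | succ k ih =>
    simp only [Function.iterate_succ_apply' (riccati A G H)] at ih ⊢
    refine riccati_mono hG ?_ ih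
    exact iterate_riccati_nonneg hG hH le_rfl k

lemma antitone_iterate_riccati {G : Matrix (Fin n) (Fin n) ℂ} (hG : 0 ≤ G) (hH : 0 ≤ H)
    (hX0 : 0 ≤ X) (hX : riccati A G H X ≤ X) : Antitone fun k => (riccati A G H)^[k] X := by
  refine antitone_nat_of_succ_le fun k => ?_
  induction k with
  | zero => exact hX
  | succ k ih =>
    simp only [Function.iterate_succ_apply' (riccati A G H)] at ih ⊢
    refine riccati_mono hG ?_ ih
    exact riccati_nonneg hG hH (iterate_riccati_nonneg hG hH hX0 k)

/-- The iterates started at `0` converge to their limit `P` with the rate given by the eigenvalues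
of the closed-loop matrix of `P` in the open unit disk. -/
lemma exists_norm_iterate_zero_sub_le {P : Matrix (Fin n) (Fin n) ℂ} (hR : R.PosDef) (hH : 0 ≤ H)
    (hlim : Tendsto (fun k => (riccati A (gMat B R) H)^[k] 0) atTop (𝓝 P))
    {t : NNReal} (ht : rhoDisk (closedLoop A B R P) < t) :
    ∃ c : ℝ, ∀ k, ‖(riccati A (gMat B R) H)^[k] 0 - P‖ ≤ c * ((t : ℝ) ^ 2) ^ k := by
  have hG : 0 ≤ gMat B R := gMat_nonneg hR
  have hle := (monotone_iterate_riccati (A := A) hG hH).ge_of_tendsto hlim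
  have hnn := iterate_riccati_nonneg (A := A) hG hH (le_refl 0)
  have hP : 0 ≤ P := hle 0
  have hfix := riccati_eq_of_tendsto hG hP hlim
  obtain ⟨s, hs, hst⟩ := ENNReal.lt_iff_exists_nnreal_btwn.1 ht
  have hs0 : 0 < s := by
    have : (0 : ℝ≥0∞) < s := lt_of_le_of_lt bot_le hs
    exact_mod_cast this
  obtain ⟨c, hc⟩ := exists_norm_conj_pow_le hP (conj_closedLoop_le hR hH hP hfix)
    (mulVec_eq_zero_of_unit_eigenvalue hR hH hP hfix hle hlim) hs
  obtain ⟨d, hd⟩ := exists_norm_le_of_conj_smul_le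
    (D := fun k => P - (riccati A (gMat B R) H)^[k] 0) (T := closedLoop A B R P)
    (norm_nonneg (gMat B R)) (fun k => sub_nonneg.2 (hle k)) (by simpa using hlim.const_sub P)
    (fun k => by
      have h := riccati_sub_le_smul (A := A) (H := H) hG (hnn k) (hle k)
      rwa [← hfix, ← closedLoop_eq hR hP,
        ← Function.iterate_succ_apply' (riccati A (gMat B R) H)] at h)
    hs0 (by exact_mod_cast hst) (by simpa using hc)
  exact ⟨d, fun k => by rw [norm_sub_rev]; exact hd k⟩

/-- Iterates that stay above a stabilizing solution `P` converge to it with the rate given by the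
spectral radius of the closed-loop matrix. -/
lemma exists_norm_iterate_sub_le {P Z : Matrix (Fin n) (Fin n) ℂ} (hR : R.PosDef)
    (hP : 0 ≤ P) (hfix : P = riccati A (gMat B R) H P) (hPZ : P ≤ Z)
    {t : NNReal} (ht : spectralRadius ℂ (closedLoop A B R P) < t) :
    ∃ c : ℝ, ∀ k, ‖(riccati A (gMat B R) H)^[k] Z - P‖ ≤ c * ((t : ℝ) ^ 2) ^ k := by
  have hG : 0 ≤ gMat B R := gMat_nonneg hR
  have hle := le_iterate_riccati hG hP hPZ hfix
  refine exists_norm_le_of_conj_le (E := fun k => (riccati A (gMat B R) H)^[k] Z - P)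
    (T := closedLoop A B R P) (fun k => sub_nonneg.2 (hle k)) (fun k => ?_) ht
  have h := riccati_sub_le (A := A) (H := H) hG hP (hle k)
  rw [← hfix, ← closedLoop_eq hR hP, ← Function.iterate_succ_apply' (riccati A (gMat B R) H)] at h
  exact h

end Solutions

section Outer

variable {n r : ℕ} {X : Triple n}

lemma outer_H (hX : X.Nonneg) (hr : 1 < r) (k : ℕ) : (outer r X k).H = X.map^[r ^ k] 0 := by
  rw [← map_outer hX hr k le_rfl, Triple.map, riccati_zero]

lemma xHat_eq (hX : X.Nonneg) (hr : 1 < r) {Z : Matrix (Fin n) (Fin n) ℂ} (hZ : 0 ≤ Z) {k : ℕ}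
    (hk : 1 ≤ k) : xHat r X Z k = X.map^[r ^ k] Z := by
  obtain ⟨k, rfl⟩ := Nat.exists_eq_add_of_le' hk
  rw [← map_outer hX hr (k + 1) hZ]
  rfl

end Outer

end AFPI

theorem theorem4p2 (n m l r : ℕ) (hr : 1 < r)
    (A : Matrix (Fin n) (Fin n) ℂ) (B : Matrix (Fin n) (Fin m) ℂ)
    (R : Matrix (Fin m) (Fin m) ℂ) (hR : R.PosDef) (C : Matrix (Fin l) (Fin n) ℂ)
    (G H : Matrix (Fin n) (Fin n) ℂ) (hG : G = AFPI.gMat B R) (hH : H = Cᴴ * C)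
    (Xs : Matrix (Fin n) (Fin n) ℂ) (hXs : Xs ∈ AFPI.riccatiDom B R)
    (hρ : spectralRadius ℂ (AFPI.closedLoop A B R Xs) < 1) :
    -- the initial matrix is well defined
    (∃! X0 : Matrix (Fin n) (Fin n) ℂ,
      X0.IsHermitian ∧ AFPI.stein (AFPI.closedLoop A B R Xs) X0 = AFPI.hMat A B R H Xs) ∧
    -- the triples of the algorithm are well defined
    (∀ k j : ℕ, j + 1 < r →
      IsUnit (1 + (AFPI.outer r ⟨A, G, H⟩ k).G *
        (AFPI.inner (AFPI.outer r ⟨A, G, H⟩ k) j).H)) ∧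
    -- the minimal solution and the convergence to it
    (∃ Xm : Matrix (Fin n) (Fin n) ℂ,
      IsLeast (AFPI.riccatiEq A B R H ∩ AFPI.psdCone n) Xm ∧
      IsLeast (AFPI.riccatiGe A B R H ∩ AFPI.psdCone n) Xm ∧
      Tendsto (fun k => (AFPI.outer r ⟨A, G, H⟩ k).H) atTop (𝓝 Xm) ∧
      AFPI.ConvergesRSuperlinearly r (fun k => (AFPI.outer r ⟨A, G, H⟩ k).H) Xm ∧
      AFPI.rootLimsup r (fun k => (AFPI.outer r ⟨A, G, H⟩ k).H) Xm ≤
        AFPI.rhoDisk (AFPI.closedLoop A B R Xm) ^ 2 ∧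
      AFPI.rhoDisk (AFPI.closedLoop A B R Xm) ^ 2 < 1) ∧
    -- the maximal solution and the convergence to it
    (∃ XM : Matrix (Fin n) (Fin n) ℂ,
      IsGreatest (AFPI.riccatiEq A B R H ∩ AFPI.psdCone n) XM ∧
      ∀ X0 : Matrix (Fin n) (Fin n) ℂ, X0.IsHermitian →
        AFPI.stein (AFPI.closedLoop A B R Xs) X0 = AFPI.hMat A B R H Xs →
        (∀ k : ℕ, IsUnit (1 + (AFPI.outer r ⟨A, G, H⟩ (k + 1)).G * X0)) ∧
        (spectralRadius ℂ (AFPI.closedLoop A B R XM) < 1 →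
          Tendsto (AFPI.xHat r ⟨A, G, H⟩ X0) atTop (𝓝 XM) ∧
          AFPI.ConvergesRSuperlinearly r (AFPI.xHat r ⟨A, G, H⟩ X0) XM ∧
          AFPI.rootLimsup r (AFPI.xHat r ⟨A, G, H⟩ X0) XM ≤
            spectralRadius ℂ (AFPI.closedLoop A B R XM) ^ 2)) := by

  have hG0 : 0 ≤ G := hG ▸ AFPI.gMat_nonneg hR
  have hH0 : 0 ≤ H := by
    rw [hH, Matrix.nonneg_iff_posSemidef]
    exact Matrix.posSemidef_conjTranspose_mul_self C
  have hT : (AFPI.Triple.mk A G H).Nonneg := ⟨hG0, hH0⟩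
  have hstein := AFPI.existsUnique_stein hρ
    (AFPI.conjTranspose_eq_of_nonneg (AFPI.hMat_nonneg (A := A) (B := B) (Xs := Xs) hR hH0))
  obtain ⟨Z, hZ, hZu⟩ := hstein
  have hZ0 : 0 ≤ Z := AFPI.nonneg_of_stein_eq hR hH0 hρ hZ.2
  have hZge : AFPI.riccati A G H Z ≤ Z := hG ▸ AFPI.riccati_le_of_stein_eq hR hZ0 hZ.2
  have hpow : Tendsto (fun k : ℕ => r ^ k) atTop atTop := tendsto_pow_atTop_atTop_of_one_lt hr
  refine ⟨⟨Z, hZ, hZu⟩, fun k j _ => ?_, ?_, ?_⟩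
  · exact AFPI.isUnit_one_add_mul (hT.outer r k).1 ((hT.outer r k).inner j).2
  · obtain ⟨P, hP, hle⟩ := AFPI.exists_tendsto_of_monotone
      (AFPI.monotone_iterate_riccati (A := A) hG0 hH0)
      (AFPI.iterate_riccati_nonneg hG0 hH0 le_rfl)
      (AFPI.iterate_riccati_le hG0 hH0 le_rfl hZ0 hZge)
    have hP0 : 0 ≤ P := hle 0
    have hfix := AFPI.riccati_eq_of_tendsto hG0 hP0 hP
    have hmin : ∀ Y, 0 ≤ Y → AFPI.riccati A G H Y ≤ Y → P ≤ Y := fun Y hY hYge =>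
      le_of_tendsto' hP (AFPI.iterate_riccati_le hG0 hH0 le_rfl hY hYge)
    have hH_eq : ∀ k, (AFPI.outer r ⟨A, G, H⟩ k).H = (AFPI.riccati A G H)^[r ^ k] 0 :=
      AFPI.outer_H hT hr
    have hrate : AFPI.rootLimsup r (fun k => (AFPI.outer r ⟨A, G, H⟩ k).H) P ≤
        AFPI.rhoDisk (AFPI.closedLoop A B R P) ^ 2 := by
      refine AFPI.rootLimsup_le_sq hr fun t ht => ?_
      subst hG
      obtain ⟨c, hc⟩ := AFPI.exists_norm_iterate_zero_sub_le hR hH0 hP ht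
      exact ⟨c, .of_forall fun k => by rw [hH_eq]; exact hc _⟩
    have hlt : AFPI.rhoDisk (AFPI.closedLoop A B R P) ^ 2 < 1 :=
      pow_lt_one₀ bot_le (AFPI.rhoDisk_lt_one _) two_ne_zero
    refine ⟨P, ⟨⟨⟨AFPI.mem_riccatiDom hR hP0, hG ▸ hfix⟩, Matrix.nonneg_iff_posSemidef.1 hP0⟩, ?_⟩,
      ⟨⟨⟨AFPI.mem_riccatiDom hR hP0, hG ▸ hfix.symm.le⟩, Matrix.nonneg_iff_posSemidef.1 hP0⟩, ?_⟩,
      ?_, AFPI.convergesRSuperlinearly_of_le hr hrate hlt, hrate, hlt⟩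
    · rintro Y ⟨⟨-, hY⟩, hY0⟩
      exact hmin Y (Matrix.nonneg_iff_posSemidef.2 hY0) (hG ▸ hY.symm.le)
    · rintro Y ⟨⟨-, hY⟩, hY0⟩
      exact hmin Y (Matrix.nonneg_iff_posSemidef.2 hY0) (hG ▸ hY)
    · simp only [hH_eq]
      exact hP.comp hpow
  · obtain ⟨P, hP, hle⟩ := AFPI.exists_tendsto_of_antitone
      (AFPI.antitone_iterate_riccati hG0 hH0 hZ0 hZge)
      (AFPI.iterate_riccati_nonneg hG0 hH0 hZ0)
    have hP0 : 0 ≤ P := ge_of_tendsto' hP (AFPI.iterate_riccati_nonneg hG0 hH0 hZ0)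
    have hfix := AFPI.riccati_eq_of_tendsto hG0 hP0 hP
    refine ⟨P, ⟨⟨⟨AFPI.mem_riccatiDom hR hP0, hG ▸ hfix⟩, Matrix.nonneg_iff_posSemidef.1 hP0⟩, ?_⟩,
      fun X0 hX0 hX0s => ?_⟩
    · rintro Y ⟨⟨-, hY⟩, hY0⟩
      have hY0' := Matrix.nonneg_iff_posSemidef.2 hY0
      exact ge_of_tendsto' hP (AFPI.le_iterate_riccati hG0 hY0'
        (AFPI.le_of_stein_eq hR hρ hZ.2 hY0' hY) (hG ▸ hY))
    · obtain rfl : X0 = Z := hZu X0 ⟨hX0, hX0s⟩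
      refine ⟨fun k => AFPI.isUnit_one_add_mul (hT.outer r (k + 1)).1 hZ0, fun hρP => ?_⟩
      have hX_eq : ∀ k, 1 ≤ k →
          AFPI.xHat r ⟨A, G, H⟩ X0 k = (AFPI.riccati A G H)^[r ^ k] X0 :=
        fun k => AFPI.xHat_eq hT hr hZ0
      have hrate : AFPI.rootLimsup r (AFPI.xHat r ⟨A, G, H⟩ X0) P ≤
          spectralRadius ℂ (AFPI.closedLoop A B R P) ^ 2 := by
        refine AFPI.rootLimsup_le_sq hr fun t ht => ?_
        subst hG
        obtain ⟨c, hc⟩ := AFPI.exists_norm_iterate_sub_le hR hP0 hfix (hle 0) ht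
        exact ⟨c, (eventually_ge_atTop 1).mono fun k hk => by rw [hX_eq k hk]; exact hc _⟩
      refine ⟨?_, AFPI.convergesRSuperlinearly_of_le hr hrate
        (pow_lt_one₀ bot_le hρP two_ne_zero), hrate⟩
      refine (hP.comp hpow).congr' ((eventually_ge_atTop 1).mono fun k hk => ?_)
      exact (hX_eq k hk).symm
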